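/- \textbf{Theorem (MQSD stability).} Let $I=(x_0,x_1)$ be a bounded interval, $p\ge 2$, $L\ge 1$. For each integer $m\ge 1$ let $\mathcal T_h=\mathcal M_h^{(0)}$ be the uniform mesh of $I$ with $2^Lm$ elements and mesh size $h=H^{(0)}$, and for $k=1,\dots,L$ let $\mathcal M_h^{(k)}$ be the uniform mesh with $2^{L-k}m$ elements and mesh size $H^{(k)}=2^kh$, obtained from $\mathcal M_h^{(k-1)}$ by removing every second interior knot; put $c_k=h/H^{(k)}$. For a mesh $\mathcal M$, let $\mathcal S^q(\mathcal M)$ be the span of the B-splines of degree $q$ on the open knot vector of $\mathcal M$ with simple interior knots. Set $V_h=\mathcal S^p(\mathcal T_h)\cap H^1_0(I)$ and $Q_L=\mathcal S^{p-1}(\mathcal M_h^{(L)})$. Write $(\cdot,\cdot)$ and $\|\cdot\|_0$ for the inner product and the norm of $L^2(I)$. Assume Hypothesis H1: there is $\alpha>0$, independent of $h$ (that is, of $m$), such that \[ \sup_{v_h\in V_h\setminus\{0\}}\frac{(v_h,q_h)}{\|v_h\|_0}\ \ge\ \alpha\,\|q_h\|_0\qquad\forall\, q_h\in Q_L . \]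 Let $b\in\mathbb R$ be a constant advection field, $c\in L^\infty(I)$, $\sigma=c-\tfrac12 b'\ (=c)$ with $\sigma\ge\sigma_0>0$ almost everywhere on $I$, and let $C_\tau>0$ and $C_\Pi$ be constants. Then there is a constant $\beta>0$, independent of $h$ and $\varepsilon$ (it may depend on $I,p,L,\alpha,b,c,\sigma_0,C_\tau,C_\Pi$), such that the following holds for every mesh of the family and every $\varepsilon>0$. Let $\Pi_k$, $k=1,\dots,L$, be linear quasi-interpolation operators $\Pi_kf=\sum_i\lambda_i^{(k)}(f)N_i$ from $H^1(I)$ to $\mathcal S^p(\mathcal M_h^{(k)})$, where the $N_i$ are the B-spline basis functions and the $\lambda^{(k)}_i$ are linear functionals on $H^1(I)$, with \[ \|f-\Pi_kf\|_{H^1(I)}\le C_\Pi\,(H^{(k)})^{s-1}\|f\|_{H^s(I)}\qquad\forall f\in H^s(I),\ 1\le s\le p+1 . \] Let the stabilization parameter satisfy \[ 0\le\tau_h\le C_\tau\,c_L^{-1}\,\frac{h^2}{\max\{\varepsilon,\,h|b|\}}, \] and define \begin{align*} s_{\mathrm{MQ}}(u,v)&=\tau_h\sum_{k=1}^Lc_k\bigl(b(u-\Pi_ku)',\,b(v-\Pi_kv)'\bigr),\\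 a_{\mathrm{MQ}}(u,v)&=\varepsilon(u',v')+(bu',v)+(cu,v)+s_{\mathrm{MQ}}(u,v),\\ \|v\|_{\mathrm{MQSD}}^2&=\varepsilon\|v'\|_0^2+\|\sigma^{1/2}v\|_0^2+s_{\mathrm{MQ}}(v,v)+\tau_hc_L\|b\,v'\|_0^2 . \end{align*} Then \[ \sup_{v_h\in V_h\setminus\{0\}}\frac{a_{\mathrm{MQ}}(u_h,v_h)}{\|v_h\|_{\mathrm{MQSD}}}\ \ge\ \beta\,\|u_h\|_{\mathrm{MQSD}}\qquad\forall\,u_h\in V_h . \] -/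

import Mathlib

open MeasureTheory Filter Topology
open scoped ContDiff

namespace MQ

noncomputable section

/-! ### B-splines on uniform meshes of an interval `I = (x₀, x₁)` -/

/-- Cox–de Boor recursion: `bspline t p i` is the `i`-th B-spline of degree `p` for the knot
sequence `t`. A fraction with zero denominator is zero, as division by zero is in Lean. -/
def bspline (t : ℕ → ℝ) : ℕ → ℕ → ℝ → ℝ
  | 0, i, x => Set.indicator (Set.Ico (t i) (t (i + 1))) (fun _ => (1 : ℝ)) x
  | p + 1, i, x =>
      (x - t i) / (t (i + p + 1) - t i) * bspline t p i x
        + (t (i + p + 2) - x) / (t (i + p + 2) - t (i + 1)) * bspline t p (i + 1) x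

/-- Mesh size of the uniform mesh of `(x₀, x₁)` with `N` elements. -/
def meshSize (x₀ x₁ : ℝ) (N : ℕ) : ℝ := (x₁ - x₀) / N

/-- Open (clamped) knot vector of degree `p` of the uniform mesh with `N` elements:
`x₀` is repeated `p + 1` times (`j = 0, …, p`), the interior knots `x₀ + h, …, x₀ + (N - 1) h` are
simple, and `x₁` is repeated `p + 1` times (`j = N + p, …, N + 2 p`). The subtraction `j - p` is the
truncated one. -/
def knot (x₀ x₁ : ℝ) (p N : ℕ) (j : ℕ) : ℝ :=
  x₀ + meshSize x₀ x₁ N * ((min (j - p) N : ℕ) : ℝ)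

/-- The B-spline basis function `N_i^p`, `0 ≤ i < N + p`, of the uniform mesh with `N` elements. -/
def basisFun (x₀ x₁ : ℝ) (p N : ℕ) (i : ℕ) : ℝ → ℝ := bspline (knot x₀ x₁ p N) p i

/-- The Schoenberg space `S^p` of the uniform mesh with `N` elements. -/
def splineSpace (x₀ x₁ : ℝ) (p N : ℕ) : Submodule ℝ (ℝ → ℝ) :=
  Submodule.span ℝ {f | ∃ i < N + p, f = basisFun x₀ x₁ p N i}

/-- The splines with homogeneous Dirichlet boundary values, `S^p ∩ H¹₀(I)`. For `p ≥ 1` a spline is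
continuous on `I` and lies in `H¹(I)`; its boundary values are the limits from inside `I`
(the B-splines, being defined through half-open intervals, all vanish at the point `x₁` itself). -/
def splineSpaceZero (x₀ x₁ : ℝ) (p N : ℕ) : Submodule ℝ (ℝ → ℝ) where
  carrier := {v | v ∈ splineSpace x₀ x₁ p N ∧
    Tendsto v (𝓝[>] x₀) (𝓝 0) ∧ Tendsto v (𝓝[<] x₁) (𝓝 0)}
  add_mem' := by
    rintro u v ⟨hu, hu0, hu1⟩ ⟨hv, hv0, hv1⟩
    refine ⟨add_mem hu hv, ?_, ?_⟩
    · have h := hu0.add hv0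
      rwa [add_zero] at h
    · have h := hu1.add hv1
      rwa [add_zero] at h
  zero_mem' := ⟨zero_mem _, tendsto_const_nhds, tendsto_const_nhds⟩
  smul_mem' := by
    rintro r v ⟨hv, hv0, hv1⟩
    refine ⟨Submodule.smul_mem _ r hv, ?_, ?_⟩
    · have h := hv0.const_smul r
      rwa [smul_zero] at h
    · have h := hv1.const_smul r
      rwa [smul_zero] at h

/-! ### Sobolev spaces `H^s(I)` through weak derivatives -/

/-- `f` and `g` are in `L²(I)` and `g` is the `k`-th weak derivative of `f` on `I = (x₀, x₁)`. -/
def IsWeakDeriv (x₀ x₁ : ℝ) (k : ℕ) (f g : ℝ → ℝ) : Prop :=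
  MemLp f 2 (volume.restrict (Set.Ioo x₀ x₁)) ∧ MemLp g 2 (volume.restrict (Set.Ioo x₀ x₁)) ∧
  ∀ φ : ℝ → ℝ, ContDiff ℝ ∞ φ → HasCompactSupport φ → tsupport φ ⊆ Set.Ioo x₀ x₁ →
    ∫ x in Set.Ioo x₀ x₁, f x * iteratedDeriv k φ x
      = (-1) ^ k * ∫ x in Set.Ioo x₀ x₁, g x * φ x

/-- `f ∈ H^s(I)`. -/
def MemSobolev (x₀ x₁ : ℝ) (s : ℕ) (f : ℝ → ℝ) : Prop :=
  ∀ k ≤ s, ∃ g, IsWeakDeriv x₀ x₁ k f g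

open Classical in
/-- A representative of the `k`-th weak derivative of `f` in `L²(I)` (unique up to null sets). -/
def weakDeriv (x₀ x₁ : ℝ) (k : ℕ) (f : ℝ → ℝ) : ℝ → ℝ :=
  if hf : ∃ g, IsWeakDeriv x₀ x₁ k f g then hf.choose else 0

/-- The inner product `(f, g)` of `L²(I)`. -/
def inner0 (x₀ x₁ : ℝ) (f g : ℝ → ℝ) : ℝ := ∫ x in Set.Ioo x₀ x₁, f x * g x

/-- The norm of `L²(I)`. -/
def norm0 (x₀ x₁ : ℝ) (f : ℝ → ℝ) : ℝ := Real.sqrt (inner0 x₀ x₁ f f)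

/-- The norm of `H^s(I)`. -/
def sobolevNorm (x₀ x₁ : ℝ) (s : ℕ) (f : ℝ → ℝ) : ℝ :=
  Real.sqrt (∑ k ∈ Finset.range (s + 1), norm0 x₀ x₁ (weakDeriv x₀ x₁ k f) ^ 2)

/-! ### The dyadic hierarchy -/

/-- Number of elements of the mesh of level `k ≤ L` when the coarsest mesh (level `L`) has `m`
elements. Level `0` is the fine mesh, and each level has every second interior knot of the
preceding one removed. -/
def numElem (L m k : ℕ) : ℕ := 2 ^ (L - k) * m

/-- Mesh size `H^(k)` of level `k`; level `0` gives `h`. -/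
def levelSize (x₀ x₁ : ℝ) (L m k : ℕ) : ℝ := meshSize x₀ x₁ (numElem L m k)

/-- The ratio `c_k = h / H^(k)`. -/
def levelRatio (x₀ x₁ : ℝ) (L m k : ℕ) : ℝ := levelSize x₀ x₁ L m 0 / levelSize x₀ x₁ L m k

/-- The fine space `V_h = S^p(𝒯_h) ∩ H¹₀(I)`. -/
def fineSpace (x₀ x₁ : ℝ) (p L m : ℕ) : Submodule ℝ (ℝ → ℝ) :=
  splineSpaceZero x₀ x₁ p (numElem L m 0)

/-- The coarse space `Q_L = S^{p-1}(ℳ_h^(L))`. -/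
def coarseSpace (x₀ x₁ : ℝ) (p L m : ℕ) : Submodule ℝ (ℝ → ℝ) :=
  splineSpace x₀ x₁ (p - 1) (numElem L m L)

/-- Hypothesis H1: the `L²` inf-sup condition between `V_h` and `Q_L`, with a constant `α` that is
the same for all meshes of the family. -/
def HypothesisH1 (x₀ x₁ : ℝ) (p L : ℕ) : Prop :=
  ∃ α : ℝ, 0 < α ∧ ∀ m : ℕ, 1 ≤ m → ∀ q ∈ coarseSpace x₀ x₁ p L m,
    α * norm0 x₀ x₁ q ≤
      sSup {r : ℝ | ∃ v ∈ fineSpace x₀ x₁ p L m, v ≠ 0 ∧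
        r = inner0 x₀ x₁ v q / norm0 x₀ x₁ v}

/-- `Q` is a linear quasi-interpolation operator `f ↦ ∑ λ_i(f) N_i^p` from `H¹(I)` to the spline
space of degree `p` on the uniform mesh with `N` elements, satisfying the approximation estimate
`‖f - Q f‖_{H¹} ≤ C H^{s-1} ‖f‖_{H^s}`, `1 ≤ s ≤ p + 1`, where `H` is the mesh size. -/
structure IsQuasiInterpolant (x₀ x₁ : ℝ) (p N : ℕ) (C : ℝ) (Q : (ℝ → ℝ) → (ℝ → ℝ)) : Prop where
  exists_functionals : ∃ lam : ℕ → (ℝ → ℝ) → ℝ,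
    (∀ i f g, MemSobolev x₀ x₁ 1 f → MemSobolev x₀ x₁ 1 g →
      lam i (f + g) = lam i f + lam i g) ∧
    (∀ i (r : ℝ) f, MemSobolev x₀ x₁ 1 f → lam i (r • f) = r * lam i f) ∧
    ∀ f, MemSobolev x₀ x₁ 1 f →
      Q f = ∑ i ∈ Finset.range (N + p), lam i f • basisFun x₀ x₁ p N i
  approx : ∀ s, 1 ≤ s → s ≤ p + 1 → ∀ f, MemSobolev x₀ x₁ s f →
    sobolevNorm x₀ x₁ 1 (f - Q f) ≤ C * meshSize x₀ x₁ N ^ (s - 1) * sobolevNorm x₀ x₁ s f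

/-! ### The stabilized form and its norms -/

/-- The streamline derivative `b · ∇v` in one dimension. -/
def streamDeriv (x₀ x₁ : ℝ) (b v : ℝ → ℝ) : ℝ → ℝ := fun x => b x * weakDeriv x₀ x₁ 1 v x

/-- `a(u, v) = ε (∇u, ∇v) + (b · ∇u, v) + (c u, v)`. -/
def aForm (x₀ x₁ ε : ℝ) (b c u v : ℝ → ℝ) : ℝ :=
  ε * inner0 x₀ x₁ (weakDeriv x₀ x₁ 1 u) (weakDeriv x₀ x₁ 1 v)
    + inner0 x₀ x₁ (streamDeriv x₀ x₁ b u) v + inner0 x₀ x₁ (fun x => c x * u x) v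

/-- `s_MQ(u, v) = τ ∑_{k=1}^L c_k ∫ (b · ∇(u - Π_k u)) (b · ∇(v - Π_k v))`, where `P k` is `Π_k`. -/
def sMQ (x₀ x₁ : ℝ) (L m : ℕ) (τ : ℝ) (P : ℕ → (ℝ → ℝ) → (ℝ → ℝ)) (b u v : ℝ → ℝ) : ℝ :=
  τ * ∑ k ∈ Finset.Icc 1 L, levelRatio x₀ x₁ L m k *
    inner0 x₀ x₁ (streamDeriv x₀ x₁ b (u - P k u)) (streamDeriv x₀ x₁ b (v - P k v))

/-- `a_MQ = a + s_MQ`. -/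
def aMQ (x₀ x₁ : ℝ) (L m : ℕ) (ε τ : ℝ) (P : ℕ → (ℝ → ℝ) → (ℝ → ℝ)) (b c u v : ℝ → ℝ) : ℝ :=
  aForm x₀ x₁ ε b c u v + sMQ x₀ x₁ L m τ P b u v

/-- `σ = c - (1/2) div b`. -/
def sigma (b c : ℝ → ℝ) : ℝ → ℝ := fun x => c x - 1 / 2 * deriv b x

/-- `‖v‖_G = (ε |v|₁² + ‖σ^{1/2} v‖₀²)^{1/2}`. -/
def normG (x₀ x₁ ε : ℝ) (b c v : ℝ → ℝ) : ℝ :=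
  Real.sqrt (ε * norm0 x₀ x₁ (weakDeriv x₀ x₁ 1 v) ^ 2
    + norm0 x₀ x₁ (fun x => Real.sqrt (sigma b c x) * v x) ^ 2)

/-- `‖v‖_MQSD = (‖v‖_G² + s_MQ(v, v) + τ c_L ‖b · ∇v‖₀²)^{1/2}`. -/
def normMQSD (x₀ x₁ : ℝ) (L m : ℕ) (ε τ : ℝ) (P : ℕ → (ℝ → ℝ) → (ℝ → ℝ))
    (b c v : ℝ → ℝ) : ℝ :=
  Real.sqrt (normG x₀ x₁ ε b c v ^ 2 + sMQ x₀ x₁ L m τ P b v v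
    + τ * levelRatio x₀ x₁ L m L * norm0 x₀ x₁ (streamDeriv x₀ x₁ b v) ^ 2)

end

end MQ

namespace MQ
noncomputable section

/-! Testing with `v = u` gives `B u u`, where `B` is the symmetric part of the form (diffusion,
reaction, stabilization): the advection term vanishes because `b` is constant and `u` has zero
boundary values. The only part of the norm that this misses is `θ b² ‖u'‖²`, with `θ = τ c_L`.

To recover it, split `u' = (u - Π_L u)' + G` with `G = (Π_L u)'`. The first piece is controlled by
the level-`L` term of the stabilization. The second lies in `Q_L`, so H1 provides `z` in `V_h` with
`(G, z)` at least a fixed multiple of `‖G‖ ‖z‖`. Scale `z`, with the sign of `b`, so that `‖z‖ = θ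
|b| ‖G‖`, and put `g² = θ b² ‖G‖²`. Then `b (G, z)` dominates a multiple of `g²`, while the
remaining terms of `a(u, z)` are at most a multiple of `g √(B u u)`. Young's inequality absorbs
these when the test function is `u + δ z` with a suitable fixed `δ`.

The norm of `z` must also be bounded by a multiple of `g`, uniformly in `h` and `ε`. This follows
from the inverse inequality `h ‖z'‖ ≤ C ‖z‖`, the `H¹` stability of `Π_k`, and the bound on `τ`,
which gives `θ ε ≤ Cτ h²` and `θ |b| ≤ Cτ h`.

The Hilbert space argument is `exists_infsup_constant`. It is fed by
`exists_spline_inverse_inequality`, `IsQuasiInterpolant.exists_derivative_error`,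
`integral_rightDeriv_mul_self` and `stabilization_energy_le`. -/

/-! ### Right derivatives of B-splines and splines. -/

/-- The right derivative of a B-spline, as a combination of B-splines of one degree less. -/
def bsplineDeriv (t : ℕ → ℝ) (p i : ℕ) (x : ℝ) : ℝ :=
  p * (bspline t (p - 1) i x / (t (i + p) - t i)
    - bspline t (p - 1) (i + 1) x / (t (i + p + 1) - t (i + 1)))

theorem hasDerivWithinAt_indicator_Ico (a b x : ℝ) :
    HasDerivWithinAt (Set.indicator (Set.Ico a b) (fun _ => (1 : ℝ))) 0 (Set.Ioi x) x := by
  have key : Set.indicator (Set.Ico a b) (fun _ => (1 : ℝ)) =ᶠ[𝓝[>] x]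
      fun _ => Set.indicator (Set.Ico a b) (fun _ => (1 : ℝ)) x := by
    rcases lt_or_ge x a with h | h
    · filter_upwards [Ioo_mem_nhdsGT h] with y hy
      rw [Set.indicator_of_notMem, Set.indicator_of_notMem] <;> simp <;> grind
    rcases lt_or_ge x b with h' | h'
    · filter_upwards [Ioo_mem_nhdsGT h'] with y hy
      rw [Set.indicator_of_mem, Set.indicator_of_mem] <;> simp <;> grind
    · filter_upwards [self_mem_nhdsWithin] with y hy
      rw [Set.indicator_of_notMem, Set.indicator_of_notMem] <;> simp <;> grind
  exact (hasDerivWithinAt_const x _ _).congr_of_eventuallyEq key rfl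

/-- Right derivatives exist at every point, knots included, because the degree-zero B-splines are
indicators of intervals closed on the left. No exceptional set has to be carried along. The formula
follows by induction on the degree from the product rule in the Cox–de Boor recursion. -/
theorem hasDerivWithinAt_bspline {t : ℕ → ℝ} (ht : Monotone t) (p i : ℕ) (x : ℝ) :
    HasDerivWithinAt (bspline t p i) (bsplineDeriv t p i x) (Set.Ioi x) x := by
  induction p generalizing i with
  | zero =>
    have := hasDerivWithinAt_indicator_Ico (t i) (t (i + 1)) x
    simpa [bsplineDeriv, bspline] using this
  | succ p ih =>
    have hl : HasDerivWithinAt (fun y => (y - t i) / (t (i + p + 1) - t i))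
        (1 / (t (i + p + 1) - t i)) (Set.Ioi x) x :=
      ((hasDerivAt_id x).sub_const _).div_const _ |>.hasDerivWithinAt
    have hr : HasDerivWithinAt (fun y => (t (i + p + 2) - y) / (t (i + p + 2) - t (i + 1)))
        (-1 / (t (i + p + 2) - t (i + 1))) (Set.Ioi x) x :=
      ((hasDerivAt_id x).const_sub _).div_const _ |>.hasDerivWithinAt
    have H := (hl.mul (ih i)).add (hr.mul (ih (i + 1)))
    have hfun : bspline t (p + 1) i = (fun y => (y - t i) / (t (i + p + 1) - t i)) * bspline t p i
        + (fun y => (t (i + p + 2) - y) / (t (i + p + 2) - t (i + 1))) * bspline t p (i + 1) := by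
      funext y; simp [bspline]
    rw [hfun]
    refine H.congr_deriv ?_
    cases p with
    | zero => simp [bsplineDeriv]; ring
    | succ q =>
      simp only [bsplineDeriv, bspline, Nat.add_sub_cancel, Nat.cast_add, Nat.cast_one]
      have e1 : i + 1 + (q + 1) = i + q + 2 := by ring
      have e2 : i + 1 + q + 1 = i + q + 2 := by ring
      have e3 : i + 1 + q + 2 = i + q + 3 := by ring
      have e6 : i + (q + 1 + 1) = i + q + 2 := by ring
      have e7 : i + (q + 1) = i + q + 1 := by ring
      have e8 : i + q + 2 + 1 = i + q + 3 := by ring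
      have e9 : i + 1 + 1 = i + 2 := by ring
      simp only [e1, e2, e3, e6, e7, e8, e9]
      generalize bspline t q i x = X
      generalize bspline t q (i + 1) x = Y
      generalize bspline t q (i + 2) x = Z
      have m1 : t i ≤ t (i + 1) := ht (by omega)
      have m2 : t (i + 1) ≤ t (i + q + 2) := ht (by omega)
      have m3 : t (i + q + 2) ≤ t (i + q + 3) := ht (by omega)
      generalize t (i + q + 1) = T1 at *
      generalize t (i + q + 2) = T2 at *
      generalize t (i + q + 3) = T3 at *
      generalize t (i + 1) = t1 at *
      generalize t (i + 2) = t2 at *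
      generalize t i = t0 at *
      simp only [div_eq_mul_inv]
      generalize (T1 - t0)⁻¹ = w1
      generalize (T3 - t2)⁻¹ = w3
      -- The outer reciprocals `w1` and `w3` can stay opaque; only the middle span `T2 - t1` must be
      -- cancelled. If it is empty, its terms vanish by the convention for division by zero.
      -- Otherwise monotonicity makes the two longer spans nonzero as well.
      rcases eq_or_lt_of_le m2 with h | h
      · rw [h]; simp; ring
      · have hA : T2 - t0 ≠ 0 := by linarith
        have hB : T3 - t1 ≠ 0 := by linarith
        have hb : T2 - t1 ≠ 0 := by linarith
        field_simp
        ring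

theorem bspline_shift (t : ℕ → ℝ) (q i : ℕ) :
    bspline t q (i + 1) = bspline (fun j => t (j + 1)) q i := by
  induction q generalizing i with
  | zero => rfl
  | succ q ih =>
    funext x
    simp only [bspline, ih]
    have e1 : i + 1 + q + 1 = i + q + 1 + 1 := by ring
    have e2 : i + 1 + q + 2 = i + q + 2 + 1 := by ring
    rw [e1, e2]

theorem meshSize_pos {x₀ x₁ : ℝ} (hx : x₀ < x₁) {N : ℕ} (hN : 1 ≤ N) : 0 < meshSize x₀ x₁ N :=
  div_pos (sub_pos.2 hx) (by exact_mod_cast hN)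

theorem meshSize_mul {x₀ x₁ : ℝ} {N : ℕ} (hN : 1 ≤ N) : meshSize x₀ x₁ N * N = x₁ - x₀ := by
  have : (N : ℝ) ≠ 0 := by positivity
  simp [meshSize, this]

theorem monotone_knot {x₀ x₁ : ℝ} (hx : x₀ < x₁) (p N : ℕ) : Monotone (knot x₀ x₁ p N) := by
  intro i j hij
  have h0 : 0 ≤ meshSize x₀ x₁ N := div_nonneg (sub_pos.2 hx).le (Nat.cast_nonneg _)
  unfold knot
  gcongr

theorem knot_succ_succ (x₀ x₁ : ℝ) (p N j : ℕ) :
    knot x₀ x₁ (p + 1) N (j + 1) = knot x₀ x₁ p N j := by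
  simp [knot]

/-- The open knot vector of degree `p` is that of degree `p + 1` shifted by one index. At the two
ends of the index range the derivative formula would leave the smaller basis, but there the
coefficient has an empty knot span as denominator and is zero. -/
theorem exists_rightDeriv {x₀ x₁ : ℝ} (hx : x₀ < x₁) {p N : ℕ} {f : ℝ → ℝ}
    (hf : f ∈ splineSpace x₀ x₁ (p + 1) N) :
    ∃ g ∈ splineSpace x₀ x₁ p N, ∀ x, HasDerivWithinAt f (g x) (Set.Ioi x) x := by
  induction hf using Submodule.span_induction with
  | mem f hf =>
    obtain ⟨i, hi, rfl⟩ := hf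
    have hsh : ∀ j, bspline (knot x₀ x₁ (p + 1) N) p (j + 1) = basisFun x₀ x₁ p N j := by
      intro j
      rw [bspline_shift]
      simp only [knot_succ_succ]
      rfl
    refine ⟨bsplineDeriv (knot x₀ x₁ (p + 1) N) (p + 1) i, ?_,
      fun x => hasDerivWithinAt_bspline (monotone_knot hx _ _) _ _ _⟩
    have hmem : ∀ j < N + p, basisFun x₀ x₁ p N j ∈ splineSpace x₀ x₁ p N :=
      fun j hj => Submodule.subset_span ⟨j, hj, rfl⟩
    have key : bsplineDeriv (knot x₀ x₁ (p + 1) N) (p + 1) i =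
        ((p + 1 : ℕ) : ℝ) • ((knot x₀ x₁ (p + 1) N (i + (p + 1)) - knot x₀ x₁ (p + 1) N i)⁻¹ •
            bspline (knot x₀ x₁ (p + 1) N) p i
          - (knot x₀ x₁ (p + 1) N (i + (p + 1) + 1) - knot x₀ x₁ (p + 1) N (i + 1))⁻¹ •
            bspline (knot x₀ x₁ (p + 1) N) p (i + 1)) := by
      funext x
      simp [bsplineDeriv, div_eq_inv_mul]
    rw [key]
    refine Submodule.smul_mem _ _ (Submodule.sub_mem _ ?_ ?_)
    · cases i with
      | zero => simp [knot]
      | succ i =>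
        rw [hsh]
        exact Submodule.smul_mem _ _ (hmem i (by omega))
    · rw [hsh]
      rcases Nat.lt_or_ge i (N + p) with h | h
      · exact Submodule.smul_mem _ _ (hmem i h)
      · have : knot x₀ x₁ (p + 1) N (i + (p + 1) + 1) = knot x₀ x₁ (p + 1) N (i + 1) := by
          unfold knot
          congr 3
          omega
        rw [this]
        simp
  | zero => exact ⟨0, zero_mem _, fun x => hasDerivWithinAt_const x _ _⟩
  | add f f' _ _ h h' =>
    obtain ⟨g, hg, hd⟩ := h
    obtain ⟨g', hg', hd'⟩ := h'
    exact ⟨g + g', add_mem hg hg', fun x => (hd x).add (hd' x)⟩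
  | smul r f _ h =>
    obtain ⟨g, hg, hd⟩ := h
    exact ⟨r • g, Submodule.smul_mem _ _ hg, fun x => (hd x).const_smul r⟩

/-! ### Continuity, boundedness and square integrability of splines. -/

/-- Repeated knots occur only outside the open interval. Inside it the function is therefore a hat,
a half hat (one end of the support being a repeated knot) or zero, and each is a maximum or minimum
of affine functions. Higher degrees inherit continuity from the recursion. -/
theorem continuousOn_bspline_one {x₀ x₁ : ℝ} {t : ℕ → ℝ} (ht : Monotone t)
    (hs : ∀ j, t j = t (j + 1) → t j ≤ x₀ ∨ x₁ ≤ t j) (i : ℕ) :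
    ContinuousOn (bspline t 1 i) (Set.Ioo x₀ x₁) := by
  have h01 : t i ≤ t (i + 1) := ht (by omega)
  have h12 : t (i + 1) ≤ t (i + 2) := ht (by omega)
  have hs0 := hs i
  have hs1 := hs (i + 1)
  have hform : ∀ x, bspline t 1 i x =
      (x - t i) / (t (i + 1) - t i) * (if t i ≤ x ∧ x < t (i + 1) then 1 else 0)
      + (t (i + 2) - x) / (t (i + 2) - t (i + 1)) *
        (if t (i + 1) ≤ x ∧ x < t (i + 2) then 1 else 0) := by
    intro x
    simp [bspline, Set.indicator_apply]
  have e : i + 1 + 1 = i + 2 := rfl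
  rw [e] at hs1
  generalize t i = a at *
  generalize t (i + 1) = b at *
  generalize t (i + 2) = c at *
  rcases eq_or_lt_of_le h01 with h | h
  · rcases hs0 h with h' | h'
    · refine ContinuousOn.congr (f := fun x => max 0 ((c - x) / (c - b)))
        (by fun_prop) fun x hx => ?_
      have h1 : ¬ (a ≤ x ∧ x < b) := by rintro ⟨_, h⟩; linarith
      have h2 : b ≤ x := by linarith [hx.1]
      rw [hform]
      by_cases h3 : x < c
      · simp only [h1, h2, h3, if_true, if_false, and_self, mul_zero, mul_one, zero_add]
        rw [max_eq_right]
        apply div_nonneg <;> linarith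
      · simp only [h1, h2, h3, if_false, and_false, mul_zero, zero_add]
        rw [max_eq_left]
        apply div_nonpos_of_nonpos_of_nonneg <;> linarith
    · refine continuousOn_const.congr fun x hx => (?_ : _ = (0 : ℝ))
      have h1 : ¬ (a ≤ x ∧ x < b) := by rintro ⟨_, h⟩; linarith [hx.2]
      have h2 : ¬ (b ≤ x ∧ x < c) := by rintro ⟨_, h⟩; linarith [hx.2]
      rw [hform]
      simp [h1, h2]
  rcases eq_or_lt_of_le h12 with h' | h'
  · rcases hs1 h' with h'' | h''
    · refine continuousOn_const.congr fun x hx => (?_ : _ = (0 : ℝ))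
      have h1 : ¬ (a ≤ x ∧ x < b) := by rintro ⟨_, h⟩; linarith [hx.1]
      have h2 : ¬ (b ≤ x ∧ x < c) := by rintro ⟨_, h⟩; linarith [hx.1]
      rw [hform]
      simp [h1, h2]
    · refine ContinuousOn.congr (f := fun x => max 0 ((x - a) / (b - a)))
        (by fun_prop) fun x hx => ?_
      have h1 : ¬ (b ≤ x ∧ x < c) := by rintro ⟨_, h⟩; linarith
      have h2 : x < b := by linarith [hx.2]
      rw [hform]
      by_cases h3 : a ≤ x
      · simp only [h1, h2, h3, if_true, if_false, and_self, mul_zero, mul_one, add_zero]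
        rw [max_eq_right]
        apply div_nonneg <;> linarith
      · simp only [h1, h2, h3, if_false, false_and, mul_zero, add_zero]
        rw [max_eq_left]
        apply div_nonpos_of_nonpos_of_nonneg <;> linarith
  · refine ContinuousOn.congr (f := fun x => max 0 (min ((x - a) / (b - a)) ((c - x) / (c - b))))
      (by fun_prop) fun x hx => ?_
    rw [hform]
    beta_reduce
    rcases lt_or_ge x a with h1 | h1
    · have : (x - a) / (b - a) ≤ 0 := by apply div_nonpos_of_nonpos_of_nonneg <;> linarith
      have h2 : ¬ (a ≤ x ∧ x < b) := by rintro ⟨_, h⟩; linarith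
      have h3 : ¬ (b ≤ x ∧ x < c) := by rintro ⟨_, h⟩; linarith
      rw [max_eq_left (min_le_of_left_le this)]
      simp [h2, h3]
    rcases lt_or_ge x b with h2 | h2
    · have e1 : 0 ≤ (x - a) / (b - a) := by apply div_nonneg <;> linarith
      have e2 : (x - a) / (b - a) ≤ 1 := by rw [div_le_one] <;> linarith
      have e3 : 1 ≤ (c - x) / (c - b) := by rw [one_le_div] <;> linarith
      rw [min_eq_left (e2.trans e3), max_eq_right e1]
      have h3 : ¬ (b ≤ x ∧ x < c) := by rintro ⟨_, h⟩; linarith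
      simp [h1, h2, h3]
    rcases lt_or_ge x c with h3 | h3
    · have e1 : 0 ≤ (c - x) / (c - b) := by apply div_nonneg <;> linarith
      have e2 : (c - x) / (c - b) ≤ 1 := by rw [div_le_one] <;> linarith
      have e3 : 1 ≤ (x - a) / (b - a) := by rw [one_le_div] <;> linarith
      rw [min_eq_right (e2.trans e3), max_eq_right e1]
      have h4 : ¬ (a ≤ x ∧ x < b) := by rintro ⟨_, h⟩; linarith
      simp only [h2, h3, h4, if_true, if_false, and_self, mul_zero, mul_one, zero_add]
    · have : (c - x) / (c - b) ≤ 0 := by apply div_nonpos_of_nonpos_of_nonneg <;> linarith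
      have h4 : ¬ (a ≤ x ∧ x < b) := by rintro ⟨_, h⟩; linarith
      have h5 : ¬ (b ≤ x ∧ x < c) := by rintro ⟨_, h⟩; linarith
      rw [max_eq_left (min_le_of_right_le this)]
      simp only [h4, h5, if_false, mul_zero, zero_add]

theorem continuousOn_bspline {x₀ x₁ : ℝ} {t : ℕ → ℝ} (ht : Monotone t)
    (hs : ∀ j, t j = t (j + 1) → t j ≤ x₀ ∨ x₁ ≤ t j) (p i : ℕ) :
    ContinuousOn (bspline t (p + 1) i) (Set.Ioo x₀ x₁) := by
  induction p generalizing i with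
  | zero => exact continuousOn_bspline_one ht hs i
  | succ p ih =>
    have h1 := ih i
    have h2 := ih (i + 1)
    exact ((by fun_prop : ContinuousOn (fun x => (x - t i) / (t (i + (p + 1) + 1) - t i)) _).mul
      h1).add ((by fun_prop : ContinuousOn (fun x => (t (i + (p + 1) + 2) - x) /
        (t (i + (p + 1) + 2) - t (i + 1))) _).mul h2)

theorem knot_le_or_ge {x₀ x₁ : ℝ} (hx : x₀ < x₁) {p N : ℕ} (hN : 1 ≤ N) (j : ℕ)
    (h : knot x₀ x₁ p N j = knot x₀ x₁ p N (j + 1)) :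
    knot x₀ x₁ p N j ≤ x₀ ∨ x₁ ≤ knot x₀ x₁ p N j := by
  have h0 := meshSize_pos hx hN
  have h1 : min (j - p) N = min (j + 1 - p) N := by
    have := mul_left_cancel₀ h0.ne' (add_left_cancel h)
    exact_mod_cast this
  rcases (by omega : min (j - p) N = 0 ∨ min (j - p) N = N) with h2 | h2
  · left; simp [knot, h2]
  · right; rw [knot, h2, meshSize_mul hN]; linarith

theorem continuousOn_of_mem_splineSpace {x₀ x₁ : ℝ} (hx : x₀ < x₁) {p N : ℕ} (hN : 1 ≤ N)
    {f : ℝ → ℝ} (hf : f ∈ splineSpace x₀ x₁ (p + 1) N) : ContinuousOn f (Set.Ioo x₀ x₁) := by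
  induction hf using Submodule.span_induction with
  | mem f hf =>
    obtain ⟨i, hi, rfl⟩ := hf
    exact continuousOn_bspline (monotone_knot hx _ _) (knot_le_or_ge hx hN) p i
  | zero => exact continuousOn_const
  | add f g _ _ hf hg => exact hf.add hg
  | smul r f _ hf => exact hf.const_smul r

theorem measurable_bspline (t : ℕ → ℝ) (p i : ℕ) : Measurable (bspline t p i) := by
  induction p generalizing i with
  | zero => exact measurable_const.indicator measurableSet_Ico
  | succ p ih =>
    have h1 := ih i
    have h2 := ih (i + 1)
    change Measurable fun x => (x - t i) / (t (i + p + 1) - t i) * bspline t p i x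
      + (t (i + p + 2) - x) / (t (i + p + 2) - t (i + 1)) * bspline t p (i + 1) x
    fun_prop

theorem exists_bound_bspline (x₀ x₁ : ℝ) (t : ℕ → ℝ) (p i : ℕ) :
    ∃ C, ∀ x ∈ Set.Ioo x₀ x₁, |bspline t p i x| ≤ C := by
  have hlin : ∀ a w : ℝ, ∃ C, ∀ x ∈ Set.Ioo x₀ x₁, |(x - a) / w| ≤ C := by
    intro a w
    refine ⟨(|x₀ - a| + |x₁ - a|) / |w|, fun x hx => ?_⟩
    rw [abs_div]
    gcongr
    have := hx.1
    have := hx.2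
    grind
  induction p generalizing i with
  | zero =>
    refine ⟨1, fun x _ => ?_⟩
    simp only [bspline, Set.indicator_apply]
    split_ifs <;> simp
  | succ p ih =>
    obtain ⟨A, hA⟩ := ih i
    obtain ⟨B, hB⟩ := ih (i + 1)
    obtain ⟨C, hC⟩ := hlin (t i) (t (i + p + 1) - t i)
    obtain ⟨D, hD⟩ := hlin (t (i + p + 2)) (t (i + p + 2) - t (i + 1))
    refine ⟨C * A + D * B, fun x hx => ?_⟩
    have hD' := hD x hx
    rw [← abs_neg, ← neg_div, neg_sub] at hD'
    simp only [bspline]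
    refine (abs_add_le _ _).trans (add_le_add ?_ ?_) <;> rw [abs_mul]
    · exact mul_le_mul (hC x hx) (hA x hx) (abs_nonneg _) ((abs_nonneg _).trans (hC x hx))
    · exact mul_le_mul hD' (hB x hx) (abs_nonneg _) ((abs_nonneg _).trans hD')

theorem measurable_of_mem_splineSpace {x₀ x₁ : ℝ} {p N : ℕ} {f : ℝ → ℝ}
    (hf : f ∈ splineSpace x₀ x₁ p N) : Measurable f := by
  induction hf using Submodule.span_induction with
  | mem f hf =>
    obtain ⟨i, hi, rfl⟩ := hf
    exact measurable_bspline _ _ _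
  | zero => exact measurable_const
  | add f g _ _ hf hg => exact hf.add hg
  | smul r f _ hf => exact hf.const_smul r

theorem exists_bound_of_mem_splineSpace {x₀ x₁ : ℝ} {p N : ℕ} {f : ℝ → ℝ}
    (hf : f ∈ splineSpace x₀ x₁ p N) : ∃ C, ∀ x ∈ Set.Ioo x₀ x₁, |f x| ≤ C := by
  induction hf using Submodule.span_induction with
  | mem f hf =>
    obtain ⟨i, hi, rfl⟩ := hf
    exact exists_bound_bspline _ _ _ _ _
  | zero => exact ⟨0, fun x _ => by simp⟩
  | add f g _ _ hf hg =>
    obtain ⟨A, hA⟩ := hf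
    obtain ⟨B, hB⟩ := hg
    exact ⟨A + B, fun x hx => (abs_add_le _ _).trans (add_le_add (hA x hx) (hB x hx))⟩
  | smul r f _ hf =>
    obtain ⟨A, hA⟩ := hf
    refine ⟨|r| * A, fun x hx => ?_⟩
    simp only [Pi.smul_apply, smul_eq_mul, abs_mul]
    exact mul_le_mul_of_nonneg_left (hA x hx) (abs_nonneg _)

theorem memLp_of_mem_splineSpace {x₀ x₁ : ℝ} {p N : ℕ} {f : ℝ → ℝ}
    (hf : f ∈ splineSpace x₀ x₁ p N) : MemLp f 2 (volume.restrict (Set.Ioo x₀ x₁)) := by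
  obtain ⟨C, hC⟩ := exists_bound_of_mem_splineSpace hf
  refine MemLp.of_bound (measurable_of_mem_splineSpace hf).aestronglyMeasurable C ?_
  exact (ae_restrict_iff' measurableSet_Ioo).2 (Eventually.of_forall hC)

/-! ### Piecewise polynomial structure and inverse inequalities. -/

theorem exists_polynomial_bspline {x₀ x₁ : ℝ} (hx : x₀ < x₁) {p N : ℕ} (hN : 1 ≤ N) (j : ℕ)
    (q i : ℕ) :
    ∃ P : Polynomial ℝ, P.natDegree ≤ q ∧
      ∀ x ∈ Set.Ico (x₀ + meshSize x₀ x₁ N * j) (x₀ + meshSize x₀ x₁ N * (j + 1 : ℕ)),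
        bspline (knot x₀ x₁ p N) q i x = P.eval x := by
  have h0 := meshSize_pos hx hN
  induction q generalizing i with
  | zero =>
    by_cases h : min (i - p) N ≤ j ∧ j + 1 ≤ min (i + 1 - p) N
    · refine ⟨1, by simp, fun x hx => ?_⟩
      have h1 : meshSize x₀ x₁ N * ((min (i - p) N : ℕ) : ℝ) ≤ meshSize x₀ x₁ N * j :=
        mul_le_mul_of_nonneg_left (by exact_mod_cast h.1) h0.le
      have h2 : meshSize x₀ x₁ N * (j + 1 : ℕ) ≤ meshSize x₀ x₁ N * ((min (i + 1 - p) N : ℕ) : ℝ) :=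
        mul_le_mul_of_nonneg_left (by exact_mod_cast h.2) h0.le
      rw [bspline, Set.indicator_of_mem, Polynomial.eval_one]
      simp only [knot]
      exact ⟨by linarith [hx.1], by linarith [hx.2]⟩
    · refine ⟨0, by simp, fun x hx => ?_⟩
      rw [bspline, Set.indicator_of_notMem, Polynomial.eval_zero]
      rintro ⟨h1, h2⟩
      simp only [knot] at h1 h2
      have h3 : meshSize x₀ x₁ N * ((min (i - p) N : ℕ) : ℝ) < meshSize x₀ x₁ N * (j + 1 : ℕ) := by
        linarith [hx.2]
      have h4 : meshSize x₀ x₁ N * j < meshSize x₀ x₁ N * ((min (i + 1 - p) N : ℕ) : ℝ) := by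
        linarith [hx.1]
      have h5 := Nat.cast_lt.1 (lt_of_mul_lt_mul_left h3 h0.le)
      have h6 := Nat.cast_lt.1 (lt_of_mul_lt_mul_left h4 h0.le)
      omega
  | succ q ih =>
    obtain ⟨A, hA, hA'⟩ := ih i
    obtain ⟨B, hB, hB'⟩ := ih (i + 1)
    set t := knot x₀ x₁ p N
    refine ⟨Polynomial.C (t (i + q + 1) - t i)⁻¹ * (Polynomial.X - Polynomial.C (t i)) * A +
      Polynomial.C (-(t (i + q + 2) - t (i + 1))⁻¹) *
        (Polynomial.X - Polynomial.C (t (i + q + 2))) * B, ?_, fun x hx => ?_⟩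
    · have hl : ∀ a w : ℝ, ∀ Q : Polynomial ℝ, Q.natDegree ≤ q →
          (Polynomial.C w * (Polynomial.X - Polynomial.C a) * Q).natDegree ≤ q + 1 := by
        intro a w Q hQ
        refine Polynomial.natDegree_mul_le.trans ?_
        have := Polynomial.natDegree_C_mul_le w (Polynomial.X - Polynomial.C a)
        rw [Polynomial.natDegree_X_sub_C] at this
        omega
      exact Polynomial.natDegree_add_le_of_degree_le (hl _ _ _ hA) (hl _ _ _ hB)
    · simp only [bspline, hA' x hx, hB' x hx, Polynomial.eval_add, Polynomial.eval_mul,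
        Polynomial.eval_C, Polynomial.eval_sub, Polynomial.eval_X]
      ring

theorem exists_polynomial_of_mem_splineSpace {x₀ x₁ : ℝ} (hx : x₀ < x₁) {p N : ℕ} (hN : 1 ≤ N)
    (j : ℕ) {f : ℝ → ℝ} (hf : f ∈ splineSpace x₀ x₁ p N) :
    ∃ P : Polynomial ℝ, P.natDegree ≤ p ∧
      ∀ x ∈ Set.Ico (x₀ + meshSize x₀ x₁ N * j) (x₀ + meshSize x₀ x₁ N * (j + 1 : ℕ)),
        f x = P.eval x := by
  induction hf using Submodule.span_induction with
  | mem f hf =>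
    obtain ⟨i, hi, rfl⟩ := hf
    exact exists_polynomial_bspline hx hN j p i
  | zero => exact ⟨0, by simp, fun x _ => by simp⟩
  | add f g _ _ hf hg =>
    obtain ⟨A, hA, hA'⟩ := hf
    obtain ⟨B, hB, hB'⟩ := hg
    exact ⟨A + B, Polynomial.natDegree_add_le_of_degree_le hA hB,
      fun x hx => by simp [hA' x hx, hB' x hx]⟩
  | smul r f _ hf =>
    obtain ⟨A, hA, hA'⟩ := hf
    exact ⟨r • A, (Polynomial.natDegree_smul_le _ _).trans hA, fun x hx => by simp [hA' x hx]⟩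

theorem inner_toLp_toLp {μ : Measure ℝ} {f g : ℝ → ℝ} (hf : MemLp f 2 μ) (hg : MemLp g 2 μ) :
    inner ℝ (hf.toLp f) (hg.toLp g) = ∫ x, f x * g x ∂μ := by
  rw [L2.inner_def]
  refine integral_congr_ae ?_
  filter_upwards [hf.coeFn_toLp, hg.coeFn_toLp] with x h1 h2
  rw [h1, h2]
  simp [mul_comm]

theorem norm_toLp_sq {μ : Measure ℝ} {f : ℝ → ℝ} (hf : MemLp f 2 μ) :
    ‖hf.toLp f‖ ^ 2 = ∫ x, f x ^ 2 ∂μ := by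
  rw [← real_inner_self_eq_norm_sq, inner_toLp_toLp]
  simp [sq]

theorem memLp_polynomial (P : Polynomial ℝ) :
    MemLp (fun x => P.eval x) 2 (volume.restrict (Set.Ioc (0 : ℝ) 1)) := by
  obtain ⟨C, hC⟩ := (isCompact_Icc (a := (0 : ℝ)) (b := 1)).exists_bound_of_continuousOn
    P.continuous.continuousOn
  refine MemLp.of_bound P.continuous.aestronglyMeasurable C ?_
  exact (ae_restrict_iff' measurableSet_Ioc).2
    (Eventually.of_forall fun x hx => hC x (Set.Ioc_subset_Icc_self hx))

/-- A polynomial as an element of `L²(0, 1)`. -/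
def polyToLp : Polynomial ℝ →ₗ[ℝ] Lp ℝ 2 (volume.restrict (Set.Ioc (0 : ℝ) 1)) where
  toFun P := (memLp_polynomial P).toLp _
  map_add' P Q := by
    rw [← MemLp.toLp_add]
    exact MemLp.toLp_congr _ _ (Eventually.of_forall fun x => by simp)
  map_smul' r P := by
    rw [RingHom.id_apply, ← MemLp.toLp_const_smul]
    exact MemLp.toLp_congr _ _ (Eventually.of_forall fun x => by simp)

theorem norm_polyToLp_sq (P : Polynomial ℝ) :
    ‖polyToLp P‖ ^ 2 = ∫ x in (0 : ℝ)..1, P.eval x ^ 2 := by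
  rw [intervalIntegral.integral_of_le zero_le_one]
  exact norm_toLp_sq (memLp_polynomial P)

theorem polyToLp_injective : Function.Injective polyToLp := by
  rw [injective_iff_map_eq_zero]
  intro P hP
  have h : ∫ x in (0 : ℝ)..1, P.eval x ^ 2 = 0 := by rw [← norm_polyToLp_sq, hP]; simp
  by_contra hne
  have hc : Continuous fun x => P.eval x ^ 2 := P.continuous.pow 2
  refine hne (Polynomial.eq_zero_of_infinite_isRoot P
    ((Set.Ioo_infinite (zero_lt_one' ℝ)).mono fun x hx => ?_))
  by_contra hx0
  have : 0 < ∫ x in (0 : ℝ)..1, P.eval x ^ 2 :=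
    intervalIntegral.integral_pos zero_lt_one hc.continuousOn (fun x _ => sq_nonneg _)
      ⟨x, Set.Ioo_subset_Icc_self hx, by positivity [show P.eval x ≠ 0 from hx0]⟩
  linarith

/-- Polynomials of degree at most `n` form a finite-dimensional space on which the `L²(0, 1)` norm
is a norm, so differentiation is bounded. The constant is the square of its operator norm, read on
the image of that space in `L²`. -/
theorem exists_polynomial_inverse_inequality (n : ℕ) :
    ∃ C : ℝ, 0 ≤ C ∧ ∀ P : Polynomial ℝ, P.natDegree ≤ n →
      ∫ x in (0 : ℝ)..1, P.derivative.eval x ^ 2 ≤ C * ∫ x in (0 : ℝ)..1, P.eval x ^ 2 := by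
  let V := Polynomial.degreeLT ℝ (n + 1)
  let T := polyToLp ∘ₗ V.subtype
  have hT : Function.Injective T := polyToLp_injective.comp V.injective_subtype
  let e := LinearEquiv.ofInjective T hT
  let F := LinearMap.toContinuousLinearMap
    (polyToLp ∘ₗ Polynomial.derivative ∘ₗ V.subtype ∘ₗ e.symm.toLinearMap)
  refine ⟨‖F‖ ^ 2, sq_nonneg _, fun P hP => ?_⟩
  have hPV : P ∈ V := Polynomial.mem_degreeLT.2
    ((Polynomial.degree_le_natDegree).trans_lt (by exact_mod_cast Nat.lt_succ_of_le hP))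
  have h := F.le_opNorm (e ⟨P, hPV⟩)
  have h1 : F (e ⟨P, hPV⟩) = polyToLp (Polynomial.derivative P) := by
    simp [F]
  have h2 : ‖e ⟨P, hPV⟩‖ = ‖polyToLp P‖ := rfl
  rw [h1, h2] at h
  rw [← norm_polyToLp_sq, ← norm_polyToLp_sq, ← mul_pow]
  gcongr

theorem exists_polynomial_inverse_inequality_interval (n : ℕ) :
    ∃ C : ℝ, 0 ≤ C ∧ ∀ P : Polynomial ℝ, P.natDegree ≤ n → ∀ a h : ℝ, 0 < h →
      h ^ 2 * ∫ x in a..(a + h), P.derivative.eval x ^ 2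
        ≤ C * ∫ x in a..(a + h), P.eval x ^ 2 := by
  obtain ⟨C, hC0, hC⟩ := exists_polynomial_inverse_inequality n
  refine ⟨C, hC0, fun P hP a h hh => ?_⟩
  let Q : Polynomial ℝ := P.comp (Polynomial.C a + Polynomial.C h * Polynomial.X)
  have hQ : Q.natDegree ≤ n := by
    have hdeg : (Polynomial.C a + Polynomial.C h * Polynomial.X).natDegree ≤ 1 := by
      compute_degree
    calc Q.natDegree ≤ P.natDegree * 1 :=
          Polynomial.natDegree_comp_le.trans (Nat.mul_le_mul_left _ hdeg)
      _ ≤ n := by simpa using hP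
  have key := hC Q hQ
  have e1 : ∀ x, Q.eval x = P.eval (a + h * x) := fun x => by simp [Q]
  have e2 : ∀ x, Q.derivative.eval x = h * P.derivative.eval (a + h * x) := fun x => by
    simp [Q, Polynomial.derivative_comp]
  simp only [e1, e2, mul_pow] at key
  rw [intervalIntegral.integral_const_mul,
    intervalIntegral.integral_comp_add_mul (fun y => P.derivative.eval y ^ 2) hh.ne',
    intervalIntegral.integral_comp_add_mul (fun y => P.eval y ^ 2) hh.ne'] at key
  simp only [mul_zero, add_zero, mul_one, smul_eq_mul] at key
  have := mul_le_mul_of_nonneg_left key hh.le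
  field_simp at this
  exact this

/-- The polynomial estimate is summed over the mesh elements. On each of them the right derivative
`g` is the derivative of the local polynomial, by uniqueness of one-sided derivatives. The constant
depends on the degree only. -/
theorem exists_spline_inverse_inequality (p : ℕ) :
    ∃ C : ℝ, 0 ≤ C ∧ ∀ x₀ x₁ : ℝ, x₀ < x₁ → ∀ N : ℕ, 1 ≤ N →
      ∀ f ∈ splineSpace x₀ x₁ p N, ∀ q, ∀ g ∈ splineSpace x₀ x₁ q N,
      (∀ x, HasDerivWithinAt f (g x) (Set.Ioi x) x) →
      meshSize x₀ x₁ N ^ 2 * ∫ x in Set.Ioo x₀ x₁, g x ^ 2 ≤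
        C * ∫ x in Set.Ioo x₀ x₁, f x ^ 2 := by
  obtain ⟨C, hC0, hC⟩ := exists_polynomial_inverse_inequality_interval p
  refine ⟨C, hC0, fun x₀ x₁ hx N hN f hf q g hg hfg => ?_⟩
  have hh := meshSize_pos hx hN
  set h := meshSize x₀ x₁ N with hdef
  let a : ℕ → ℝ := fun j => x₀ + h * j
  have ha : ∀ j, a (j + 1) = a j + h := fun j => by simp only [a]; push_cast; ring
  have ha0 : a 0 = x₀ := by simp [a]
  have haN : a N = x₁ := by simp only [a]; rw [hdef, meshSize_mul hN]; ring
  have hmono : Monotone a := monotone_nat_of_le_succ fun j => by rw [ha]; linarith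
  have hsum : ∀ u : ℝ → ℝ, MemLp u 2 (volume.restrict (Set.Ioo x₀ x₁)) →
      ∫ x in Set.Ioo x₀ x₁, u x ^ 2 =
        ∑ j ∈ Finset.range N, ∫ x in (a j)..(a (j + 1)), u x ^ 2 := by
    intro u hu
    have hint : IntervalIntegrable (fun x => u x ^ 2) volume x₀ x₁ := by
      rw [intervalIntegrable_iff_integrableOn_Ioo_of_le hx.le]
      exact hu.integrable_sq
    rw [intervalIntegral.sum_integral_adjacent_intervals, ha0, haN,
      intervalIntegral.integral_of_le hx.le, integral_Ioc_eq_integral_Ioo]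
    intro k hk
    refine hint.mono_set ?_
    rw [Set.uIcc_of_le (hmono k.le_succ), Set.uIcc_of_le hx.le, ← ha0, ← haN]
    exact Set.Icc_subset_Icc (hmono (Nat.zero_le _)) (hmono hk)
  rw [hsum f (memLp_of_mem_splineSpace hf), hsum g (memLp_of_mem_splineSpace hg),
    Finset.mul_sum, Finset.mul_sum]
  refine Finset.sum_le_sum fun j _ => ?_
  obtain ⟨P, hP, hfP⟩ := exists_polynomial_of_mem_splineSpace hx hN j hf
  have hgP : ∀ x ∈ Set.Ico (a j) (a (j + 1)), g x = P.derivative.eval x := by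
    intro x hxj
    have h1 : HasDerivWithinAt (fun y => P.eval y) (P.derivative.eval x) (Set.Ioi x) x :=
      (P.hasDerivAt x).hasDerivWithinAt
    have h2 : f =ᶠ[𝓝[>] x] fun y => P.eval y := by
      filter_upwards [Ioo_mem_nhdsGT hxj.2] with y hy
      exact hfP y ⟨hxj.1.trans hy.1.le, hy.2⟩
    exact (uniqueDiffWithinAt_Ioi x).eq_deriv _ (hfg x)
      (h1.congr_of_eventuallyEq h2 (hfP x hxj))
  have hcongr : ∀ u v : ℝ → ℝ, (∀ x ∈ Set.Ico (a j) (a (j + 1)), u x = v x) →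
      ∫ x in (a j)..(a (j + 1)), u x ^ 2 = ∫ x in (a j)..(a (j + 1)), v x ^ 2 := by
    intro u v huv
    rw [intervalIntegral.integral_of_le (hmono j.le_succ),
      intervalIntegral.integral_of_le (hmono j.le_succ), integral_Ioc_eq_integral_Ioo,
      integral_Ioc_eq_integral_Ioo]
    exact setIntegral_congr_fun measurableSet_Ioo fun x hx => by
      simp only [huv x (Set.Ioo_subset_Ico_self hx)]
  rw [hcongr g _ hgP, hcongr f _ hfP, ha]
  exact hC P hP _ _ hh

/-! ### Weak derivatives and Sobolev spaces. -/

/-- Boundary values enter as one-sided limits, since the point value of a spline at `x₁` is always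
zero. The fundamental theorem is applied to the continuous extension to the closed interval. -/
theorem integral_eq_sub_of_rightDeriv_of_tendsto {a b A B : ℝ} (hab : a < b) {f g : ℝ → ℝ}
    (hf : ContinuousOn f (Set.Ioo a b))
    (hd : ∀ x ∈ Set.Ioo a b, HasDerivWithinAt f (g x) (Set.Ioi x) x)
    (hg : IntegrableOn g (Set.Ioo a b))
    (ha : Tendsto f (𝓝[>] a) (𝓝 A)) (hb : Tendsto f (𝓝[<] b) (𝓝 B)) :
    ∫ x in Set.Ioo a b, g x = B - A := by
  have hF := continuousOn_Icc_extendFrom_Ioo hf ha hb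
  have heq : ∀ x ∈ Set.Ioo a b, extendFrom (Set.Ioo a b) f x = f x := fun x hx =>
    extendFrom_extends hf x hx
  have := intervalIntegral.integral_eq_sub_of_hasDeriv_right_of_le hab.le hF (f' := g)
    (fun x hx => (hd x hx).congr_of_eventuallyEq (by
      filter_upwards [Ioo_mem_nhdsGT hx.2] with y hy
      exact heq y ⟨hx.1.trans hy.1, hy.2⟩) (heq x hx))
    ((intervalIntegrable_iff_integrableOn_Ioo_of_le hab.le).2 hg)
  rw [eq_lim_at_left_extendFrom_Ioo hab ha, eq_lim_at_right_extendFrom_Ioo hab hb,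
    intervalIntegral.integral_of_le hab.le, integral_Ioc_eq_integral_Ioo] at this
  exact this

theorem integrable_mul_of_memLp {μ : Measure ℝ} {f g : ℝ → ℝ} (hf : MemLp f 2 μ)
    (hg : MemLp g 2 μ) : Integrable (fun x => f x * g x) μ :=
  hf.integrable_mul hg

theorem isWeakDeriv_one_of_rightDeriv {x₀ x₁ : ℝ} (hx : x₀ < x₁) {f g : ℝ → ℝ}
    (hf : ContinuousOn f (Set.Ioo x₀ x₁))
    (hd : ∀ x ∈ Set.Ioo x₀ x₁, HasDerivWithinAt f (g x) (Set.Ioi x) x)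
    (hfL : MemLp f 2 (volume.restrict (Set.Ioo x₀ x₁)))
    (hgL : MemLp g 2 (volume.restrict (Set.Ioo x₀ x₁))) : IsWeakDeriv x₀ x₁ 1 f g := by
  refine ⟨hfL, hgL, fun φ hφ hφc hφs => ?_⟩
  have hφ1 : Differentiable ℝ φ := hφ.differentiable (by simp)
  have hφ' : Continuous (deriv φ) := hφ.continuous_deriv (by simp)
  have hLφ : ∀ ψ : ℝ → ℝ, Continuous ψ → HasCompactSupport ψ →
      MemLp ψ 2 (volume.restrict (Set.Ioo x₀ x₁)) := fun ψ h h' =>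
    (h.memLp_of_hasCompactSupport h').restrict _
  have i1 : Integrable (fun x => g x * φ x) (volume.restrict (Set.Ioo x₀ x₁)) :=
    hgL.integrable_mul (hLφ φ hφ.continuous hφc)
  have i2 : Integrable (fun x => f x * deriv φ x) (volume.restrict (Set.Ioo x₀ x₁)) :=
    hfL.integrable_mul (hLφ _ hφ' hφc.deriv)
  have hz : ∀ x, x ∉ Set.Ioo x₀ x₁ → (fun x => f x * φ x) =ᶠ[𝓝 x] 0 := by
    intro x hx'
    have := notMem_tsupport_iff_eventuallyEq.1 (fun h => hx' (hφs h))
    filter_upwards [this] with y hy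
    simp [hy]
  have key := integral_eq_sub_of_rightDeriv_of_tendsto (f := fun x => f x * φ x)
    (g := fun x => g x * φ x + f x * deriv φ x) hx (hf.mul hφ.continuous.continuousOn)
    (fun x hx => (hd x hx).mul (hφ1 x).hasDerivAt.hasDerivWithinAt) (i1.add i2)
    (A := 0) (B := 0)
    (tendsto_const_nhds.congr' ((hz x₀ (by simp)).filter_mono nhdsWithin_le_nhds).symm)
    (tendsto_const_nhds.congr' ((hz x₁ (by simp)).filter_mono nhdsWithin_le_nhds).symm)
  rw [integral_add i1 i2] at key
  simp only [iteratedDeriv_one]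
  linarith

theorem isWeakDeriv_zero {x₀ x₁ : ℝ} {f : ℝ → ℝ}
    (hf : MemLp f 2 (volume.restrict (Set.Ioo x₀ x₁))) : IsWeakDeriv x₀ x₁ 0 f f :=
  ⟨hf, hf, fun φ _ _ _ => by simp⟩

theorem IsWeakDeriv.ae_eq {x₀ x₁ : ℝ} {k : ℕ} {f g g' : ℝ → ℝ} (h : IsWeakDeriv x₀ x₁ k f g)
    (h' : IsWeakDeriv x₀ x₁ k f g') : g =ᵐ[volume.restrict (Set.Ioo x₀ x₁)] g' := by
  have hL := h.2.1.sub h'.2.1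
  have hloc : LocallyIntegrableOn (g - g') (Set.Ioo x₀ x₁) := by
    have : IntegrableOn (g - g') (Set.Ioo x₀ x₁) := hL.integrable (by norm_num)
    exact this.locallyIntegrableOn
  have key := isOpen_Ioo.ae_eq_zero_of_integral_contDiff_smul_eq_zero (μ := volume) hloc
    fun φ hφ hφc hφs => ?_
  · rw [EventuallyEq, ae_restrict_iff' measurableSet_Ioo]
    filter_upwards [key] with x hx hxm
    have := hx hxm
    simpa [sub_eq_zero] using this
  · have hLφ : MemLp φ 2 (volume.restrict (Set.Ioo x₀ x₁)) :=
      (hφ.continuous.memLp_of_hasCompactSupport hφc).restrict _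
    have e1 := h.2.2 φ hφ hφc hφs
    have e2 := h'.2.2 φ hφ hφc hφs
    have e3 : ∫ x in Set.Ioo x₀ x₁, g x * φ x = ∫ x in Set.Ioo x₀ x₁, g' x * φ x :=
      mul_left_cancel₀ (pow_ne_zero k (by norm_num : (-1 : ℝ) ≠ 0)) (e1.symm.trans e2)
    have e4 : ∫ x in Set.Ioo x₀ x₁, φ x • (g - g') x = 0 := by
      have : ∀ x, φ x • (g - g') x = g x * φ x - g' x * φ x := fun x => by simp; ring
      simp only [this]
      rw [integral_sub (integrable_mul_of_memLp h.2.1 hLφ) (integrable_mul_of_memLp h'.2.1 hLφ), e3, sub_self]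
    rw [← e4]
    symm
    apply setIntegral_eq_integral_of_forall_compl_eq_zero
    intro x hx
    rw [image_eq_zero_of_notMem_tsupport (fun h => hx (hφs h)), zero_smul]

theorem weakDeriv_spec {x₀ x₁ : ℝ} {k : ℕ} {f : ℝ → ℝ} (h : ∃ g, IsWeakDeriv x₀ x₁ k f g) :
    IsWeakDeriv x₀ x₁ k f (weakDeriv x₀ x₁ k f) := by
  rw [weakDeriv, dif_pos h]
  exact h.choose_spec

theorem IsWeakDeriv.weakDeriv_ae_eq {x₀ x₁ : ℝ} {k : ℕ} {f g : ℝ → ℝ}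
    (h : IsWeakDeriv x₀ x₁ k f g) :
    weakDeriv x₀ x₁ k f =ᵐ[volume.restrict (Set.Ioo x₀ x₁)] g :=
  (weakDeriv_spec ⟨g, h⟩).ae_eq h

theorem memLp_weakDeriv (x₀ x₁ : ℝ) (k : ℕ) (f : ℝ → ℝ) :
    MemLp (weakDeriv x₀ x₁ k f) 2 (volume.restrict (Set.Ioo x₀ x₁)) := by
  by_cases h : ∃ g, IsWeakDeriv x₀ x₁ k f g
  · exact (weakDeriv_spec h).2.1
  · rw [weakDeriv, dif_neg h]
    exact MemLp.zero

theorem contDiff_memLp_iteratedDeriv {x₀ x₁ : ℝ} {φ : ℝ → ℝ} (hφ : ContDiff ℝ ∞ φ)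
    (hφc : HasCompactSupport φ) (k : ℕ) :
    MemLp (iteratedDeriv k φ) 2 (volume.restrict (Set.Ioo x₀ x₁)) :=
  ((hφ.continuous_iteratedDeriv k (by exact_mod_cast le_top)).memLp_of_hasCompactSupport
    (by
      induction k with
      | zero => simpa using hφc
      | succ k ih => rw [iteratedDeriv_succ]; exact ih.deriv)).restrict _

theorem IsWeakDeriv.add {x₀ x₁ : ℝ} {k : ℕ} {f g f' g' : ℝ → ℝ} (h : IsWeakDeriv x₀ x₁ k f g)
    (h' : IsWeakDeriv x₀ x₁ k f' g') : IsWeakDeriv x₀ x₁ k (f + f') (g + g') := by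
  refine ⟨h.1.add h'.1, h.2.1.add h'.2.1, fun φ hφ hφc hφs => ?_⟩
  have hLφ := contDiff_memLp_iteratedDeriv (x₀ := x₀) (x₁ := x₁) hφ hφc
  have h0 := hLφ 0
  rw [iteratedDeriv_zero] at h0
  simp only [Pi.add_apply, add_mul]
  rw [integral_add (integrable_mul_of_memLp h.1 (hLφ k)) (integrable_mul_of_memLp h'.1 (hLφ k)),
    integral_add (integrable_mul_of_memLp h.2.1 h0) (integrable_mul_of_memLp h'.2.1 h0),
    h.2.2 φ hφ hφc hφs, h'.2.2 φ hφ hφc hφs, mul_add]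

theorem IsWeakDeriv.const_smul {x₀ x₁ : ℝ} {k : ℕ} {f g : ℝ → ℝ} (h : IsWeakDeriv x₀ x₁ k f g)
    (r : ℝ) : IsWeakDeriv x₀ x₁ k (r • f) (r • g) := by
  refine ⟨h.1.const_smul r, h.2.1.const_smul r, fun φ hφ hφc hφs => ?_⟩
  simp only [Pi.smul_apply, smul_eq_mul, mul_assoc]
  rw [integral_const_mul, integral_const_mul, h.2.2 φ hφ hφc hφs]
  ring

/-- `H^s(I)` as a space of functions. -/
def sobolevSpace (x₀ x₁ : ℝ) (s : ℕ) : Submodule ℝ (ℝ → ℝ) where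
  carrier := {f | MemSobolev x₀ x₁ s f}
  add_mem' := fun hf hg k hk => by
    obtain ⟨u, hu⟩ := hf k hk
    obtain ⟨v, hv⟩ := hg k hk
    exact ⟨u + v, hu.add hv⟩
  zero_mem' := fun k _ => ⟨0, MemLp.zero, MemLp.zero, fun φ _ _ _ => by simp⟩
  smul_mem' := fun r f hf k hk => by
    obtain ⟨u, hu⟩ := hf k hk
    exact ⟨r • u, hu.const_smul r⟩

/-- The weak derivative as a linear map into `L²(I)`. -/
def weakDerivL (x₀ x₁ : ℝ) {s k : ℕ} (hk : k ≤ s) :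
    sobolevSpace x₀ x₁ s →ₗ[ℝ] Lp ℝ 2 (volume.restrict (Set.Ioo x₀ x₁)) where
  toFun f := (memLp_weakDeriv x₀ x₁ k f).toLp _
  map_add' f g := by
    rw [← MemLp.toLp_add]
    exact MemLp.toLp_congr _ _ ((weakDeriv_spec (f.2 k hk)).add
      (weakDeriv_spec (g.2 k hk))).weakDeriv_ae_eq
  map_smul' r f := by
    rw [RingHom.id_apply, ← MemLp.toLp_const_smul]
    exact MemLp.toLp_congr _ _ ((weakDeriv_spec (f.2 k hk)).const_smul r).weakDeriv_ae_eq

theorem isWeakDeriv_one_of_mem_splineSpace {x₀ x₁ : ℝ} (hx : x₀ < x₁) {p N q : ℕ} (hN : 1 ≤ N)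
    {f g : ℝ → ℝ} (hf : f ∈ splineSpace x₀ x₁ (p + 1) N) (hg : g ∈ splineSpace x₀ x₁ q N)
    (hd : ∀ x, HasDerivWithinAt f (g x) (Set.Ioi x) x) : IsWeakDeriv x₀ x₁ 1 f g :=
  isWeakDeriv_one_of_rightDeriv hx (continuousOn_of_mem_splineSpace hx hN hf) (fun x _ => hd x)
    (memLp_of_mem_splineSpace hf) (memLp_of_mem_splineSpace hg)

theorem splineSpace_le_sobolevSpace {x₀ x₁ : ℝ} (hx : x₀ < x₁) {p N : ℕ} (hN : 1 ≤ N) :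
    splineSpace x₀ x₁ (p + 1) N ≤ sobolevSpace x₀ x₁ 1 := by
  intro f hf k hk
  obtain ⟨g, hg, hd⟩ := exists_rightDeriv hx hf
  interval_cases k
  · exact ⟨f, isWeakDeriv_zero (memLp_of_mem_splineSpace hf)⟩
  · exact ⟨g, isWeakDeriv_one_of_mem_splineSpace hx hN hf hg hd⟩

/-- The integrand is half the derivative of `f²`, whose boundary limits vanish. This is why constant
advection contributes nothing to the form on the diagonal. -/
theorem integral_rightDeriv_mul_self {x₀ x₁ : ℝ} (hx : x₀ < x₁) {p N q : ℕ} (hN : 1 ≤ N)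
    {f g : ℝ → ℝ} (hf : f ∈ splineSpaceZero x₀ x₁ (p + 1) N) (hg : g ∈ splineSpace x₀ x₁ q N)
    (hd : ∀ x, HasDerivWithinAt f (g x) (Set.Ioi x) x) :
    ∫ x in Set.Ioo x₀ x₁, g x * f x = 0 := by
  have hc := continuousOn_of_mem_splineSpace hx hN hf.1
  have hi : IntegrableOn (fun x => g x * f x) (Set.Ioo x₀ x₁) :=
    (memLp_of_mem_splineSpace hg).integrable_mul (memLp_of_mem_splineSpace hf.1)
  have := integral_eq_sub_of_rightDeriv_of_tendsto (f := fun x => f x * f x)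
    (g := fun x => g x * f x + f x * g x) hx (hc.mul hc)
    (fun x _ => (hd x).mul (hd x)) (hi.add (by simpa only [mul_comm] using hi))
    (hf.2.1.mul hf.2.1) (hf.2.2.mul hf.2.2)
  have e : ∀ x, g x * f x + f x * g x = 2 * (g x * f x) := fun x => by ring
  simp only [e, integral_const_mul] at this
  linarith

/-! ### The inf-sup argument in an abstract Hilbert space setting. -/

/-- The scalar core of the argument: `X` stands for `B u u`, `Y` for the missing term `θ b² ‖D u‖²`,
`g²` for `θ b² ‖G‖²`, `auz` for the form at `(u, z)`, and `nz`, `nv` for the squared norms of `z`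
and of `u + δ z`. -/
theorem exists_coercivity_constants {α K : ℝ} (hα : 0 < α) (hK : 0 < K) :
    ∃ δ κ C : ℝ, 0 < κ ∧ 0 < C ∧ ∀ X Y g auz nz nv : ℝ, 0 ≤ X → 0 ≤ Y → 0 ≤ g →
      Y ≤ 2 * g ^ 2 + 2 * X → g ^ 2 ≤ 2 * X + 2 * Y → α * g ^ 2 - K * g * √X ≤ auz →
      nz ≤ K * g ^ 2 → nv ≤ 2 * (X + Y) + 2 * δ ^ 2 * nz →
      κ * (X + Y) ≤ X + δ * auz ∧ √nv ≤ C * √(X + Y) := by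
  -- With `δ = α / K²`, Young's inequality costs exactly `X / 2` and leaves `X / 2 + α² / (2 K²)
  -- g²`. Since `X + Y ≤ 3 X + 2 g²`, the two entries of the minimum are what each summand allows.
  refine ⟨α / K ^ 2, min (1 / 6) (α ^ 2 / (4 * K ^ 2)), √(2 + 4 * (α / K ^ 2) ^ 2 * K),
    by positivity, by positivity, ?_⟩
  intro X Y g auz nz nv hX hY hg h1 h2 h3 h4 h5
  constructor
  · have hs : √X ^ 2 = X := Real.sq_sqrt hX
    have e : K * g * √X ≤ α / 2 * g ^ 2 + K ^ 2 / (2 * α) * X := by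
      have : 0 ≤ (α * g - K * √X) ^ 2 / (2 * α) := by positivity
      have e' : (α * g - K * √X) ^ 2 / (2 * α)
          = α / 2 * g ^ 2 - K * g * √X + K ^ 2 / (2 * α) * √X ^ 2 := by
        field_simp
        ring
      rw [hs] at e'
      linarith
    have e2 : α / K ^ 2 * (α / 2 * g ^ 2 - K ^ 2 / (2 * α) * X) ≤ α / K ^ 2 * auz :=
      mul_le_mul_of_nonneg_left (by linarith) (by positivity)
    have e3 : α / K ^ 2 * (α / 2 * g ^ 2 - K ^ 2 / (2 * α) * X)
        = 2 * (α ^ 2 / (4 * K ^ 2)) * g ^ 2 - 1 / 2 * X := by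
      field_simp
      ring
    have m1 := min_le_left (1 / 6) (α ^ 2 / (4 * K ^ 2))
    have m2 := min_le_right (1 / 6) (α ^ 2 / (4 * K ^ 2))
    have m0 : 0 ≤ min (1 / 6) (α ^ 2 / (4 * K ^ 2)) := by positivity
    generalize min (1 / 6) (α ^ 2 / (4 * K ^ 2)) = κ at *
    have n1 : κ * (X + Y) ≤ κ * (3 * X + 2 * g ^ 2) := mul_le_mul_of_nonneg_left (by linarith) m0
    have n2 : κ * X ≤ 1 / 6 * X := mul_le_mul_of_nonneg_right m1 hX
    have n3 := mul_le_mul_of_nonneg_right m2 (sq_nonneg g)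
    linarith
  · rw [← Real.sqrt_mul (by positivity)]
    apply Real.sqrt_le_sqrt
    have e1 : nz ≤ K * (2 * X + 2 * Y) := h4.trans (mul_le_mul_of_nonneg_left h2 hK.le)
    have e2 := mul_le_mul_of_nonneg_left e1 (by positivity : 0 ≤ 2 * (α / K ^ 2) ^ 2)
    linarith

section Abstract

variable {V E : Type*} [AddCommGroup V] [Module ℝ V] [NormedAddCommGroup E]
  [InnerProductSpace ℝ E]

/-- The inf-sup vector for `G` is scaled so that `‖J z‖ = θ |b| ‖G‖`, which turns `hinv` into the
bound on the norm of `z`. Cauchy–Schwarz costs `√K` for `B u z` and `1` for the part `D u - G`. If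
`√θ |b| ‖G‖` vanishes, `z = 0` suffices. -/
theorem exists_test_vector {B : LinearMap.BilinForm ℝ V} (hB : ∀ v, 0 ≤ B v v)
    (hsymm : LinearMap.IsSymm B) {D J : V →ₗ[ℝ] E} {b θ α K : ℝ} (hθ : 0 ≤ θ) (hK : 0 ≤ K) (u : V) (G : E)
    (hG : θ * b ^ 2 * ‖D u - G‖ ^ 2 ≤ B u u)
    (hinv : b ≠ 0 → ∀ z, θ * (B z z + θ * b ^ 2 * ‖D z‖ ^ 2) ≤ K * ‖J z‖ ^ 2)
    (hinf : G ≠ 0 → ∃ z, J z ≠ 0 ∧ α * ‖G‖ * ‖J z‖ ≤ inner ℝ G (J z)) :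
    ∃ z, α * (√θ * |b| * ‖G‖) ^ 2 - (√K + 1) * (√θ * |b| * ‖G‖) * √(B u u)
        ≤ B u z + b * inner ℝ (D u) (J z) ∧
      B z z + θ * b ^ 2 * ‖D z‖ ^ 2 ≤ K * (√θ * |b| * ‖G‖) ^ 2 := by
  by_cases h0 : √θ * |b| * ‖G‖ = 0
  · exact ⟨0, by simp [h0], by simp [h0]⟩
  have hθ0 : θ ≠ 0 := by rintro rfl; simp at h0
  have hb : b ≠ 0 := by rintro rfl; simp at h0
  have hG0 : G ≠ 0 := by rintro rfl; simp at h0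
  obtain ⟨w, hw, hwG⟩ := hinf hG0
  have hw' : ‖J w‖ ≠ 0 := norm_ne_zero_iff.2 hw
  have hsθ : √θ ^ 2 = θ := Real.sq_sqrt hθ
  set r : ℝ := θ * b * ‖G‖ / ‖J w‖ with hr
  set g : ℝ := √θ * |b| * ‖G‖ with hg
  have hg0 : 0 ≤ g := by positivity
  have hJ : ‖J (r • w)‖ = √θ * g := by
    have : |r| = θ * |b| * ‖G‖ / ‖J w‖ := by
      rw [hr, abs_div, abs_mul, abs_mul, abs_of_nonneg hθ, abs_norm, abs_norm]
    rw [map_smul, norm_smul, Real.norm_eq_abs, this, hg]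
    field_simp
    rw [hsθ]
  have hn : B (r • w) (r • w) + θ * b ^ 2 * ‖D (r • w)‖ ^ 2 ≤ K * g ^ 2 := by
    have := hinv hb (r • w)
    rw [hJ, mul_pow, hsθ] at this
    have hpos : 0 < θ := lt_of_le_of_ne hθ (Ne.symm hθ0)
    refine le_of_mul_le_mul_left ?_ hpos
    linarith
  refine ⟨r • w, ?_, hn⟩
  have hBz : B (r • w) (r • w) ≤ K * g ^ 2 := by
    have : 0 ≤ θ * b ^ 2 * ‖D (r • w)‖ ^ 2 := by positivity
    linarith
  have c1 : |B u (r • w)| ≤ √(B u u) * (√K * g) := by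
    apply abs_le_of_sq_le_sq _ (by positivity)
    calc B u (r • w) ^ 2 ≤ B u u * B (r • w) (r • w) :=
          LinearMap.BilinForm.apply_sq_le_of_symm B hB hsymm u (r • w)
      _ ≤ B u u * (K * g ^ 2) := mul_le_mul_of_nonneg_left hBz (hB u)
      _ = (√(B u u) * (√K * g)) ^ 2 := by
          rw [mul_pow (√(B u u)), mul_pow (√K), Real.sq_sqrt (hB u), Real.sq_sqrt hK]
  have c2 : |b * inner ℝ (D u - G) (J (r • w))| ≤ √(B u u) * g := by
    have hd : √θ * |b| * ‖D u - G‖ ≤ √(B u u) := by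
      apply Real.le_sqrt_of_sq_le
      rw [mul_pow, mul_pow, hsθ, sq_abs]
      exact hG
    calc |b * inner ℝ (D u - G) (J (r • w))| = |b| * |inner ℝ (D u - G) (J (r • w))| := abs_mul _ _
      _ ≤ |b| * (‖D u - G‖ * ‖J (r • w)‖) :=
          mul_le_mul_of_nonneg_left (abs_real_inner_le_norm _ _) (abs_nonneg _)
      _ = (√θ * |b| * ‖D u - G‖) * g := by rw [hJ]; ring
      _ ≤ √(B u u) * g := mul_le_mul_of_nonneg_right hd hg0
  have c3 : α * g ^ 2 ≤ b * inner ℝ G (J (r • w)) := by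
    rw [map_smul, inner_smul_right]
    have hrb : 0 ≤ b * r := by
      have : b * r = θ * b ^ 2 * ‖G‖ / ‖J w‖ := by rw [hr]; ring
      rw [this]; positivity
    calc α * g ^ 2 = (b * r) * (α * ‖G‖ * ‖J w‖) := by
          rw [hg, hr, mul_pow, mul_pow, hsθ, sq_abs]
          field_simp
      _ ≤ (b * r) * inner ℝ G (J w) := mul_le_mul_of_nonneg_left hwG hrb
      _ = _ := by ring
  have c4 : b * inner ℝ (D u) (J (r • w)) =
      b * inner ℝ (D u - G) (J (r • w)) + b * inner ℝ G (J (r • w)) := by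
    rw [inner_sub_left]; ring
  have c5 := neg_le_of_abs_le c1
  have c6 := neg_le_of_abs_le c2
  rw [c4]
  linarith

theorem two_mul_form_add_le {B : LinearMap.BilinForm ℝ V} (hB : ∀ v, 0 ≤ B v v) (u z : V) :
    B (u + z) (u + z) ≤ 2 * B u u + 2 * B z z := by
  have h := hB (u - z)
  simp only [map_add, map_sub, LinearMap.add_apply, LinearMap.sub_apply] at h ⊢
  linarith

theorem norm_add_sq_le_two_mul (x y : E) : ‖x + y‖ ^ 2 ≤ 2 * ‖x‖ ^ 2 + 2 * ‖y‖ ^ 2 := by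
  have h := parallelogram_law_with_norm ℝ x y
  nlinarith [sq_nonneg ‖x - y‖]

/-- The real `sSup` bounds its elements only when the set is bounded above. The bound here may
depend on `u` and all other data, as it never enters the final constant. -/
theorem bddAbove_quotients {B : LinearMap.BilinForm ℝ V} (hB : ∀ v, 0 ≤ B v v)
    (hsymm : LinearMap.IsSymm B) {D J : V →ₗ[ℝ] E} {b θ σ₀ : ℝ} (hθ : 0 ≤ θ) (hσ₀ : 0 < σ₀)
    (hJ : ∀ v, σ₀ * ‖J v‖ ^ 2 ≤ B v v) (u : V) :
    ∃ M, ∀ v, B u v + b * inner ℝ (D u) (J v) ≤ M * √(B v v + θ * b ^ 2 * ‖D v‖ ^ 2) := by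
  refine ⟨√(B u u) + |b| * ‖D u‖ / √σ₀, fun v => ?_⟩
  have h1 : √(B v v) ≤ √(B v v + θ * b ^ 2 * ‖D v‖ ^ 2) :=
    Real.sqrt_le_sqrt (le_add_of_nonneg_right (by positivity))
  have h2 : B u v ≤ √(B u u) * √(B v v) := by
    apply le_of_abs_le
    apply abs_le_of_sq_le_sq _ (by positivity)
    rw [mul_pow, Real.sq_sqrt (hB u), Real.sq_sqrt (hB v)]
    exact LinearMap.BilinForm.apply_sq_le_of_symm B hB hsymm u v
  have h3 : ‖J v‖ ≤ √(B v v) / √σ₀ := by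
    rw [le_div_iff₀ (Real.sqrt_pos.2 hσ₀)]
    apply Real.le_sqrt_of_sq_le
    rw [mul_pow, Real.sq_sqrt hσ₀.le, mul_comm]
    exact hJ v
  have h4 : b * inner ℝ (D u) (J v) ≤ |b| * ‖D u‖ / √σ₀ * √(B v v) := by
    calc b * inner ℝ (D u) (J v) ≤ |b| * |inner ℝ (D u) (J v)| := by
          rw [← abs_mul]; exact le_abs_self _
      _ ≤ |b| * (‖D u‖ * (√(B v v) / √σ₀)) :=
          mul_le_mul_of_nonneg_left ((abs_real_inner_le_norm _ _).trans
            (mul_le_mul_of_nonneg_left h3 (norm_nonneg _))) (abs_nonneg _)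
      _ = _ := by ring
  calc _ ≤ (√(B u u) + |b| * ‖D u‖ / √σ₀) * √(B v v) := by linarith
    _ ≤ _ := mul_le_mul_of_nonneg_left h1 (by positivity)

end Abstract

/-- The constant is fixed before the spaces, forms and parameters are introduced. This order
expresses independence of `h`, `ε`, `τ` and the operators `Π_k`. -/
theorem exists_infsup_constant {α K : ℝ} (hα : 0 < α) (hK : 0 ≤ K) :
    ∃ β : ℝ, 0 < β ∧ ∀ (V E : Type) [AddCommGroup V] [Module ℝ V] [NormedAddCommGroup E]
      [InnerProductSpace ℝ E] (B : LinearMap.BilinForm ℝ V) (D J : V →ₗ[ℝ] E) (b θ σ₀ : ℝ)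
      (G : V → E), (∀ v, 0 ≤ B v v) → LinearMap.IsSymm B → 0 ≤ θ → 0 < σ₀ →
      (∀ v, σ₀ * ‖J v‖ ^ 2 ≤ B v v) →
      (∀ u, inner ℝ (D u) (J u) = 0) →
      (∀ u, θ * b ^ 2 * ‖D u - G u‖ ^ 2 ≤ B u u) →
      (b ≠ 0 → ∀ z, θ * (B z z + θ * b ^ 2 * ‖D z‖ ^ 2) ≤ K * ‖J z‖ ^ 2) →
      (∀ u, G u ≠ 0 → ∃ z, J z ≠ 0 ∧ α * ‖G u‖ * ‖J z‖ ≤ inner ℝ (G u) (J z)) →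
      ∀ u, β * √(B u u + θ * b ^ 2 * ‖D u‖ ^ 2) ≤
        sSup {r : ℝ | ∃ v : V, v ≠ 0 ∧ r = (B u v + b * inner ℝ (D u) (J v)) /
          √(B v v + θ * b ^ 2 * ‖D v‖ ^ 2)} := by
  obtain ⟨δ, κ, C, hκ, hC, hmain⟩ := exists_coercivity_constants hα
    -- A single constant dominating both the norm factor `K` and the Cauchy–Schwarz factor `√K + 1`.
    (by positivity : 0 < K + (√K + 1))
  refine ⟨κ / C, by positivity, ?_⟩
  intro V E _ _ _ _ B D J b θ σ₀ G hB hsymm hθ hσ₀ hJ hDJ hG hinv hinf u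
  set n : V → ℝ := fun v => B v v + θ * b ^ 2 * ‖D v‖ ^ 2 with hn
  set a : V → ℝ := fun v => B u v + b * inner ℝ (D u) (J v) with ha
  have hn0 : ∀ v, 0 ≤ n v := fun v => by have := hB v; simp only [hn]; positivity
  obtain ⟨M, hM⟩ := bddAbove_quotients (D := D) (b := b) hB hsymm hθ hσ₀ hJ u
  change ∀ v, a v ≤ M * √(n v) at hM
  change κ / C * √(n u) ≤ sSup {r : ℝ | ∃ v : V, v ≠ 0 ∧ r = a v / √(n v)}
  have hbdd : BddAbove {r : ℝ | ∃ v : V, v ≠ 0 ∧ r = a v / √(n v)} := by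
    refine ⟨max M 0, ?_⟩
    rintro _ ⟨v, -, rfl⟩
    rcases eq_or_lt_of_le (Real.sqrt_nonneg (n v)) with h | h
    · rw [← h]; simp
    · exact ((div_le_iff₀ h).2 (hM v)).trans (le_max_left _ _)
  rcases eq_or_lt_of_le (hn0 u) with hu | hu
  -- The supremum only has to be nonnegative. Among `v` and `-v` one quotient is nonnegative, and
  -- over the trivial space the supremum of the empty set is zero.
  · rw [← hu, Real.sqrt_zero, mul_zero]
    by_cases hne : ∃ v : V, v ≠ 0
    · obtain ⟨v, hv⟩ := hne
      have hneg : a (-v) / √(n (-v)) = -(a v / √(n v)) := by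
        simp only [ha, hn, map_neg, LinearMap.neg_apply, norm_neg, inner_neg_right, neg_neg]
        ring
      rcases le_total 0 (a v / √(n v)) with h | h
      · exact h.trans (le_csSup hbdd ⟨v, hv, rfl⟩)
      · have : 0 ≤ a (-v) / √(n (-v)) := by rw [hneg]; linarith
        exact this.trans (le_csSup hbdd ⟨-v, neg_ne_zero.2 hv, rfl⟩)
    · have : {r : ℝ | ∃ v : V, v ≠ 0 ∧ r = a v / √(n v)} = ∅ := by
        ext r
        simp only [Set.mem_ofPred_eq, Set.mem_empty_iff_false, iff_false]
        rintro ⟨v, hv, -⟩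
        exact hne ⟨v, hv⟩
      rw [this, Real.sSup_empty]
  · obtain ⟨z, hz1, hz2⟩ := exists_test_vector (J := J) hB hsymm hθ hK u (G u) (hG u) hinv (hinf u)
    have hsθ : √θ ^ 2 = θ := Real.sq_sqrt hθ
    have hθb : 0 ≤ θ * b ^ 2 := by positivity
    have hg2 : (√θ * |b| * ‖G u‖) ^ 2 = θ * b ^ 2 * ‖G u‖ ^ 2 := by
      rw [mul_pow, mul_pow, hsθ, sq_abs]
    have hg0 : 0 ≤ √θ * |b| * ‖G u‖ := by positivity
    generalize √θ * |b| * ‖G u‖ = g at *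
    obtain ⟨k1, k2⟩ := hmain (B u u) (θ * b ^ 2 * ‖D u‖ ^ 2) g (a z) (n z) (n (u + δ • z))
      (hB u) (by positivity) hg0
      (by
        have := norm_add_sq_le_two_mul (G u) (D u - G u)
        rw [add_sub_cancel] at this
        have := mul_le_mul_of_nonneg_left this hθb
        have := hG u
        rw [hg2]
        linarith)
      (by
        have := norm_add_sq_le_two_mul (D u) (-(D u - G u))
        rw [norm_neg, ← sub_eq_add_neg, sub_sub_cancel] at this
        have := mul_le_mul_of_nonneg_left this hθb
        have := hG u
        rw [hg2]
        linarith)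
      (by
        refine le_trans ?_ hz1
        have : 0 ≤ K * g * √(B u u) := by positivity
        linarith)
      (by
        refine le_trans hz2 ?_
        have : 0 ≤ (√K + 1) * g ^ 2 := by positivity
        linarith)
      (by
        have h1 := two_mul_form_add_le hB u (δ • z)
        have h2 := norm_add_sq_le_two_mul (D u) (D (δ • z))
        rw [← map_add] at h2
        have h3 := mul_le_mul_of_nonneg_left h2 hθb
        have h4 : B (δ • z) (δ • z) = δ ^ 2 * B z z := by simp; ring
        have h5 : ‖D (δ • z)‖ ^ 2 = δ ^ 2 * ‖D z‖ ^ 2 := by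
          rw [map_smul, norm_smul, mul_pow, Real.norm_eq_abs, sq_abs]
        rw [h4] at h1
        rw [h5] at h3
        simp only [hn]
        linarith)
    have hav : a (u + δ • z) = B u u + δ * a z := by
      simp only [ha, map_add, map_smul, inner_add_right, inner_smul_right, hDJ u, smul_eq_mul]
      ring
    rw [← hav] at k1
    change κ * n u ≤ _ at k1
    change _ ≤ C * √(n u) at k2
    generalize u + δ • z = v at *
    have hav0 : 0 < a v := lt_of_lt_of_le (by positivity) k1
    -- Division by zero is excluded: `a v` is positive and at most `M * √(n v)`.
    have hv0 : 0 < √(n v) := by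
      refine lt_of_le_of_ne (Real.sqrt_nonneg _) fun h => ?_
      have := hM v
      rw [← h, mul_zero] at this
      linarith
    have hvne : v ≠ 0 := by
      rintro rfl
      simp [ha] at hav0
    refine le_trans ?_ (le_csSup hbdd ⟨v, hvne, rfl⟩)
    rw [le_div_iff₀ hv0]
    calc κ / C * √(n u) * √(n v) ≤ κ / C * √(n u) * (C * √(n u)) := by gcongr
      _ = κ * (√(n u)) ^ 2 := by field_simp
      _ = κ * n u := by rw [Real.sq_sqrt (hn0 u)]
      _ ≤ a v := k1

/-! ### From functions on the interval to `L²`, quasi-interpolation, H1 and parameter bounds. -/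

theorem inner0_eq_inner {x₀ x₁ : ℝ} {f g : ℝ → ℝ}
    (hf : MemLp f 2 (volume.restrict (Set.Ioo x₀ x₁)))
    (hg : MemLp g 2 (volume.restrict (Set.Ioo x₀ x₁))) :
    inner0 x₀ x₁ f g = inner ℝ (hf.toLp f) (hg.toLp g) :=
  (inner_toLp_toLp hf hg).symm

theorem norm0_eq_norm {x₀ x₁ : ℝ} {f : ℝ → ℝ}
    (hf : MemLp f 2 (volume.restrict (Set.Ioo x₀ x₁))) : norm0 x₀ x₁ f = ‖hf.toLp f‖ := by
  rw [norm0, inner0_eq_inner hf hf, real_inner_self_eq_norm_sq, Real.sqrt_sq (norm_nonneg _)]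

/-- Multiplication by an essentially bounded function, from `H^s(I)` to `L²(I)`. -/
def mulL {x₀ x₁ : ℝ} (s : ℕ) {w : ℝ → ℝ} (hw : MemLp w ⊤ (volume.restrict (Set.Ioo x₀ x₁))) :
    sobolevSpace x₀ x₁ s →ₗ[ℝ] Lp ℝ 2 (volume.restrict (Set.Ioo x₀ x₁)) where
  toFun f := ((weakDeriv_spec (f.2 0 (Nat.zero_le _))).1.mul (p := ⊤) (r := 2) hw).toLp _
  map_add' f g := by
    rw [← MemLp.toLp_add]
    exact MemLp.toLp_congr _ _ (Eventually.of_forall fun x => by simp [mul_add])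
  map_smul' r f := by
    rw [RingHom.id_apply, ← MemLp.toLp_const_smul]
    exact MemLp.toLp_congr _ _ (Eventually.of_forall fun x => by simp; ring)

theorem memLp_one_top (x₀ x₁ : ℝ) :
    MemLp (fun _ => (1 : ℝ)) ⊤ (volume.restrict (Set.Ioo x₀ x₁)) := memLp_const 1

/-- The embedding of `H^s(I)` into `L²(I)`. -/
def embL (x₀ x₁ : ℝ) (s : ℕ) :
    sobolevSpace x₀ x₁ s →ₗ[ℝ] Lp ℝ 2 (volume.restrict (Set.Ioo x₀ x₁)) :=
  mulL s (memLp_one_top x₀ x₁)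

theorem embL_apply {x₀ x₁ : ℝ} {s : ℕ} (f : sobolevSpace x₀ x₁ s)
    (hf : MemLp f.1 2 (volume.restrict (Set.Ioo x₀ x₁))) : embL x₀ x₁ s f = hf.toLp f.1 :=
  MemLp.toLp_congr (hf.mul (p := ⊤) (r := 2) (memLp_one_top x₀ x₁)) _ (Eventually.of_forall fun x => by simp)

theorem memLp_of_mem_sobolevSpace {x₀ x₁ : ℝ} {s : ℕ} (f : sobolevSpace x₀ x₁ s) :
    MemLp f.1 2 (volume.restrict (Set.Ioo x₀ x₁)) :=
  (weakDeriv_spec (f.2 0 (Nat.zero_le _))).1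

theorem weakDerivL_apply {x₀ x₁ : ℝ} {s k : ℕ} (hk : k ≤ s) (f : sobolevSpace x₀ x₁ s) :
    weakDerivL x₀ x₁ hk f = (memLp_weakDeriv x₀ x₁ k f).toLp _ := rfl

theorem weakDerivL_eq {x₀ x₁ : ℝ} {s k : ℕ} (hk : k ≤ s) (f : sobolevSpace x₀ x₁ s) {g : ℝ → ℝ}
    (h : IsWeakDeriv x₀ x₁ k f g) : weakDerivL x₀ x₁ hk f = h.2.1.toLp g :=
  MemLp.toLp_congr (memLp_weakDeriv x₀ x₁ k f) _ h.weakDeriv_ae_eq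

theorem sobolevNorm_one_sq {x₀ x₁ : ℝ} (f : sobolevSpace x₀ x₁ 1) :
    sobolevNorm x₀ x₁ 1 f ^ 2 = ‖embL x₀ x₁ 1 f‖ ^ 2 + ‖weakDerivL x₀ x₁ le_rfl f‖ ^ 2 := by
  have hf := memLp_of_mem_sobolevSpace f
  have h0 : norm0 x₀ x₁ (weakDeriv x₀ x₁ 0 f) = ‖embL x₀ x₁ 1 f‖ := by
    rw [norm0_eq_norm (memLp_weakDeriv x₀ x₁ 0 f), embL_apply f hf]
    exact congrArg _ (MemLp.toLp_congr _ _ (isWeakDeriv_zero hf).weakDeriv_ae_eq)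
  rw [sobolevNorm, Real.sq_sqrt (by positivity), Finset.sum_range_succ, Finset.sum_range_one, h0,
    norm0_eq_norm (memLp_weakDeriv x₀ x₁ 1 f), weakDerivL_apply]

/-- `R` is the map `f ↦ (f - Q f)'`, linear because the coefficient functionals are linear on `H¹`.
The case `s = 1` of the approximation estimate bounds it, and `f' - R f = (Q f)'` is a spline of one
degree less; at level `L` this places it in `Q_L`. -/
theorem IsQuasiInterpolant.exists_derivative_error {x₀ x₁ : ℝ} (hx : x₀ < x₁) {p N : ℕ}
    (hN : 1 ≤ N) {C : ℝ} {Q : (ℝ → ℝ) → (ℝ → ℝ)} (hQ : IsQuasiInterpolant x₀ x₁ (p + 1) N C Q) :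
    ∃ R : sobolevSpace x₀ x₁ 1 →ₗ[ℝ] Lp ℝ 2 (volume.restrict (Set.Ioo x₀ x₁)),
      (∀ f : sobolevSpace x₀ x₁ 1,
        R f = (memLp_weakDeriv x₀ x₁ 1 (f.1 - Q f.1)).toLp _) ∧
      (∀ f, ‖R f‖ ^ 2 ≤ C ^ 2 * (‖embL x₀ x₁ 1 f‖ ^ 2 + ‖weakDerivL x₀ x₁ le_rfl f‖ ^ 2)) ∧
      ∀ f, ∃ g, ∃ hg : g ∈ splineSpace x₀ x₁ p N,
        weakDerivL x₀ x₁ le_rfl f - R f = (memLp_of_mem_splineSpace hg).toLp g := by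
  obtain ⟨lam, hadd, hsmul, hrep⟩ := hQ.exists_functionals
  have hspl : ∀ f : sobolevSpace x₀ x₁ 1, Q f.1 ∈ splineSpace x₀ x₁ (p + 1) N := by
    intro f
    rw [hrep f.1 f.2]
    exact Submodule.sum_mem _ fun i hi => Submodule.smul_mem _ _
      (Submodule.subset_span ⟨i, Finset.mem_range.1 hi, rfl⟩)
  let T : sobolevSpace x₀ x₁ 1 →ₗ[ℝ] sobolevSpace x₀ x₁ 1 :=
    { toFun := fun f => ⟨Q f.1, splineSpace_le_sobolevSpace hx hN (hspl f)⟩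
      map_add' := fun f g => by
        apply Subtype.ext
        change Q (f.1 + g.1) = Q f.1 + Q g.1
        rw [hrep _ f.2, hrep _ g.2, hrep (f.1 + g.1) (f + g).2, ← Finset.sum_add_distrib]
        exact Finset.sum_congr rfl fun i _ => by rw [hadd i _ _ f.2 g.2, add_smul]
      map_smul' := fun r f => by
        apply Subtype.ext
        change Q (r • f.1) = r • Q f.1
        rw [hrep _ f.2, hrep (r • f.1) (r • f).2, Finset.smul_sum]
        exact Finset.sum_congr rfl fun i _ => by rw [hsmul i _ _ f.2, mul_smul] }
  let S : sobolevSpace x₀ x₁ 1 →ₗ[ℝ] sobolevSpace x₀ x₁ 1 := LinearMap.id - T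
  refine ⟨weakDerivL x₀ x₁ le_rfl ∘ₗ S, fun f => rfl, fun f => ?_, fun f => ?_⟩
  · have h := hQ.approx 1 le_rfl (by omega) f.1 f.2
    rw [Nat.sub_self, pow_zero, mul_one] at h
    have h1 := sobolevNorm_one_sq (S f)
    have h2 : sobolevNorm x₀ x₁ 1 (f.1 - Q f.1) ^ 2 ≤ (C * sobolevNorm x₀ x₁ 1 f.1) ^ 2 :=
      pow_le_pow_left₀ (Real.sqrt_nonneg _) h 2
    rw [mul_pow, sobolevNorm_one_sq f] at h2
    change sobolevNorm x₀ x₁ 1 (f.1 - Q f.1) ^ 2 = _ at h1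
    rw [h1] at h2
    refine le_trans ?_ h2
    exact le_add_of_nonneg_left (sq_nonneg _)
  · obtain ⟨g, hg, hd⟩ := exists_rightDeriv hx (hspl f)
    refine ⟨g, hg, ?_⟩
    have : weakDerivL x₀ x₁ le_rfl f - (weakDerivL x₀ x₁ le_rfl ∘ₗ S) f
        = weakDerivL x₀ x₁ le_rfl (T f) := by simp [S]
    rw [this]
    exact weakDerivL_eq le_rfl (T f) (isWeakDeriv_one_of_mem_splineSpace hx hN (hspl f) hg hd)

/-- Halving `α` makes the inequality strict, so that an actual test function replaces the supremum.
A strictly positive quotient also rules out `norm0 v = 0`, for which the quotient would be zero. -/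
theorem HypothesisH1.exists_test_function {x₀ x₁ : ℝ} {p L : ℕ} (h : HypothesisH1 x₀ x₁ p L) :
    ∃ α : ℝ, 0 < α ∧ ∀ m : ℕ, 1 ≤ m → ∀ q ∈ coarseSpace x₀ x₁ p L m, norm0 x₀ x₁ q ≠ 0 →
      ∃ v ∈ fineSpace x₀ x₁ p L m, norm0 x₀ x₁ v ≠ 0 ∧
        α * norm0 x₀ x₁ q * norm0 x₀ x₁ v ≤ inner0 x₀ x₁ v q := by
  obtain ⟨α, hα, H⟩ := h
  refine ⟨α / 2, half_pos hα, fun m hm q hq hq0 => ?_⟩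
  have hq1 : 0 < norm0 x₀ x₁ q := lt_of_le_of_ne (Real.sqrt_nonneg _) (Ne.symm hq0)
  have h1 : α / 2 * norm0 x₀ x₁ q < sSup {r : ℝ | ∃ v ∈ fineSpace x₀ x₁ p L m, v ≠ 0 ∧
      r = inner0 x₀ x₁ v q / norm0 x₀ x₁ v} := by
    refine lt_of_lt_of_le ?_ (H m hm q hq)
    have : 0 < α * norm0 x₀ x₁ q := by positivity
    linarith
  have hne : {r : ℝ | ∃ v ∈ fineSpace x₀ x₁ p L m, v ≠ 0 ∧
      r = inner0 x₀ x₁ v q / norm0 x₀ x₁ v}.Nonempty := by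
    by_contra hemp
    rw [Set.not_nonempty_iff_eq_empty.1 hemp, Real.sSup_empty] at h1
    have : 0 < α / 2 * norm0 x₀ x₁ q := by positivity
    linarith
  obtain ⟨_, ⟨v, hv, -, rfl⟩, hlt⟩ := exists_lt_of_lt_csSup hne h1
  have hv0 : norm0 x₀ x₁ v ≠ 0 := by
    intro h0
    rw [h0, div_zero] at hlt
    have : 0 < α / 2 * norm0 x₀ x₁ q := by positivity
    linarith
  have hv1 : 0 < norm0 x₀ x₁ v := lt_of_le_of_ne (Real.sqrt_nonneg _) (Ne.symm hv0)
  exact ⟨v, hv, hv0, ((lt_div_iff₀ hv1).1 hlt).le⟩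

theorem one_le_numElem {m : ℕ} (hm : 1 ≤ m) (L k : ℕ) : 1 ≤ numElem L m k :=
  Nat.mul_pos (by positivity) hm

theorem levelRatio_eq {x₀ x₁ : ℝ} (hx : x₀ < x₁) {L m k : ℕ} (hm : 1 ≤ m) (hk : k ≤ L) :
    levelRatio x₀ x₁ L m k = (2 ^ k)⁻¹ := by
  have h1 : x₁ - x₀ ≠ 0 := (sub_pos.2 hx).ne'
  have h2 : (m : ℝ) ≠ 0 := by positivity
  obtain ⟨j, rfl⟩ := Nat.exists_eq_add_of_le hk
  simp only [levelRatio, levelSize, meshSize, numElem, Nat.sub_zero, Nat.add_sub_cancel_left]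
  push_cast
  rw [pow_add]
  field_simp

theorem levelSize_zero_le {x₀ x₁ : ℝ} (hx : x₀ < x₁) {L m : ℕ} (hm : 1 ≤ m) :
    levelSize x₀ x₁ L m 0 ≤ x₁ - x₀ :=
  div_le_self (sub_pos.2 hx).le (by exact_mod_cast one_le_numElem hm L 0)

/-- This is the bound required by `hinv`, with `j = ‖z‖²`, `d = ‖z'‖²`, `S` the reaction part and
`s` the stabilization. The bound on `θ` gives `θ ε ≤ Cτ h²`, `θ |b| ≤ Cτ h` and `θ ≤ Cτ ℓ / |b|`.
Each factor `h²` is then spent either on the inverse inequality or on `h ≤ ℓ`. -/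
theorem stabilization_energy_le {b Cτ Ci Kc Q ℓ h θ ε s r d S j γ : ℝ} (hb : b ≠ 0) (hCτ : 0 < Cτ)
    (hKc : 0 ≤ Kc) (hh : 0 < h) (hℓ : h ≤ ℓ) (hθ : 0 ≤ θ) (hε : 0 < ε) (hγ : 0 ≤ γ)
    (hθle : θ ≤ Cτ * (h ^ 2 / max ε (h * |b|))) (hd0 : 0 ≤ d) (hj0 : 0 ≤ j)
    (hd : h ^ 2 * d ≤ Ci * j) (hS : S ≤ Kc * j) (hr : r ≤ Q ^ 2 * (j + d))
    (hs : s ≤ θ * γ * (b ^ 2 * r)) :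
    θ * (ε * d + S + s + θ * b ^ 2 * d) ≤
      (Cτ * Ci + Cτ * ℓ / |b| * Kc + γ * Q ^ 2 * Cτ ^ 2 * (ℓ ^ 2 + Ci) + Cτ ^ 2 * Ci) * j := by
  have hb' : 0 < |b| := abs_pos.2 hb
  have hmax : 0 < max ε (h * |b|) := lt_max_of_lt_left hε
  have h1 : θ * max ε (h * |b|) ≤ Cτ * h ^ 2 := by
    rw [← mul_div_assoc] at hθle
    exact (le_div_iff₀ hmax).1 hθle
  have h2 : θ * ε ≤ Cτ * h ^ 2 :=
    (mul_le_mul_of_nonneg_left (le_max_left _ _) hθ).trans h1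
  have h3 : θ * |b| ≤ Cτ * h := by
    have : θ * (h * |b|) ≤ Cτ * h ^ 2 :=
      (mul_le_mul_of_nonneg_left (le_max_right _ _) hθ).trans h1
    refine le_of_mul_le_mul_right ?_ hh
    linarith
  have h4 : θ ≤ Cτ * ℓ / |b| := by
    rw [le_div_iff₀ hb']
    exact h3.trans (mul_le_mul_of_nonneg_left hℓ hCτ.le)
  have h5 : θ ^ 2 * b ^ 2 ≤ Cτ ^ 2 * h ^ 2 := by
    rw [← sq_abs b, ← mul_pow, ← mul_pow]
    exact pow_le_pow_left₀ (by positivity) h3 2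
  have t1 : θ * ε * d ≤ Cτ * Ci * j := by
    calc θ * ε * d ≤ Cτ * h ^ 2 * d := mul_le_mul_of_nonneg_right h2 hd0
      _ = Cτ * (h ^ 2 * d) := by ring
      _ ≤ Cτ * (Ci * j) := mul_le_mul_of_nonneg_left hd hCτ.le
      _ = _ := by ring
  have t2 : θ * S ≤ Cτ * ℓ / |b| * Kc * j := by
    calc θ * S ≤ θ * (Kc * j) := mul_le_mul_of_nonneg_left hS hθ
      _ ≤ Cτ * ℓ / |b| * (Kc * j) := mul_le_mul_of_nonneg_right h4 (by positivity)
      _ = _ := by ring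
  have t4 : θ ^ 2 * b ^ 2 * d ≤ Cτ ^ 2 * Ci * j := by
    calc θ ^ 2 * b ^ 2 * d ≤ Cτ ^ 2 * h ^ 2 * d := mul_le_mul_of_nonneg_right h5 hd0
      _ = Cτ ^ 2 * (h ^ 2 * d) := by ring
      _ ≤ Cτ ^ 2 * (Ci * j) := mul_le_mul_of_nonneg_left hd (by positivity)
      _ = _ := by ring
  have t3 : θ * s ≤ γ * Q ^ 2 * Cτ ^ 2 * (ℓ ^ 2 + Ci) * j := by
    have hhl : h ^ 2 * j ≤ ℓ ^ 2 * j :=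
      mul_le_mul_of_nonneg_right (pow_le_pow_left₀ hh.le hℓ 2) hj0
    calc θ * s ≤ θ * (θ * γ * (b ^ 2 * r)) := mul_le_mul_of_nonneg_left hs hθ
      _ = θ ^ 2 * b ^ 2 * (γ * r) := by ring
      _ ≤ θ ^ 2 * b ^ 2 * (γ * (Q ^ 2 * (j + d))) := by gcongr
      _ ≤ Cτ ^ 2 * h ^ 2 * (γ * (Q ^ 2 * (j + d))) :=
          mul_le_mul_of_nonneg_right h5 (by positivity)
      _ = γ * Q ^ 2 * Cτ ^ 2 * (h ^ 2 * j + h ^ 2 * d) := by ring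
      _ ≤ γ * Q ^ 2 * Cτ ^ 2 * (ℓ ^ 2 * j + Ci * j) := by gcongr
      _ = _ := by ring
  linarith

/-! ### The symmetric energy form and multiplication operators. -/

/-- The pullback of the inner product along a linear map. -/
def pullbackInner {V E : Type*} [AddCommGroup V] [Module ℝ V] [NormedAddCommGroup E]
    [InnerProductSpace ℝ E] (T : V →ₗ[ℝ] E) : LinearMap.BilinForm ℝ V :=
  (innerₗ E).compl₁₂ T T

theorem pullbackInner_apply {V E : Type*} [AddCommGroup V] [Module ℝ V] [NormedAddCommGroup E]
    [InnerProductSpace ℝ E] (T : V →ₗ[ℝ] E) (u v : V) :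
    pullbackInner T u v = inner ℝ (T u) (T v) := rfl

/-- The symmetric part of the stabilized form. -/
def energyForm {V E : Type*} [AddCommGroup V] [Module ℝ V] [NormedAddCommGroup E]
    [InnerProductSpace ℝ E] (ε τ b : ℝ) (L : ℕ) (w : ℕ → ℝ) (D S : V →ₗ[ℝ] E)
    (R : ℕ → V →ₗ[ℝ] E) : LinearMap.BilinForm ℝ V :=
  ε • pullbackInner D + pullbackInner S
    + τ • ∑ k ∈ Finset.Icc 1 L, (w k * b ^ 2) • pullbackInner (R k)

section Energy

variable {V E : Type*} [AddCommGroup V] [Module ℝ V] [NormedAddCommGroup E]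
  [InnerProductSpace ℝ E] {ε τ b : ℝ} {L : ℕ} {w : ℕ → ℝ} {D S : V →ₗ[ℝ] E}
  {R : ℕ → V →ₗ[ℝ] E}

theorem energyForm_apply (u v : V) : energyForm ε τ b L w D S R u v =
    ε * inner ℝ (D u) (D v) + inner ℝ (S u) (S v)
      + τ * ∑ k ∈ Finset.Icc 1 L, w k * b ^ 2 * inner ℝ (R k u) (R k v) := by
  simp [energyForm, pullbackInner_apply, LinearMap.sum_apply]

theorem energyForm_self (v : V) : energyForm ε τ b L w D S R v v =
    ε * ‖D v‖ ^ 2 + ‖S v‖ ^ 2 + τ * ∑ k ∈ Finset.Icc 1 L, w k * b ^ 2 * ‖R k v‖ ^ 2 := by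
  simp [energyForm_apply]

theorem isSymm_energyForm : LinearMap.IsSymm (energyForm ε τ b L w D S R) :=
  ⟨fun u v => by simp [energyForm_apply, real_inner_comm]⟩

theorem energyForm_nonneg (hε : 0 ≤ ε) (hτ : 0 ≤ τ) (hw : ∀ k ∈ Finset.Icc 1 L, 0 ≤ w k) (v : V) :
    0 ≤ energyForm ε τ b L w D S R v v := by
  rw [energyForm_self]
  have : 0 ≤ ∑ k ∈ Finset.Icc 1 L, w k * b ^ 2 * ‖R k v‖ ^ 2 :=
    Finset.sum_nonneg fun k hk => by have := hw k hk; positivity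
  positivity

theorem norm_sq_le_energyForm (hε : 0 ≤ ε) (hτ : 0 ≤ τ) (hw : ∀ k ∈ Finset.Icc 1 L, 0 ≤ w k)
    (v : V) : ‖S v‖ ^ 2 ≤ energyForm ε τ b L w D S R v v := by
  rw [energyForm_self]
  have : 0 ≤ ∑ k ∈ Finset.Icc 1 L, w k * b ^ 2 * ‖R k v‖ ^ 2 :=
    Finset.sum_nonneg fun k hk => by have := hw k hk; positivity
  have : 0 ≤ ε * ‖D v‖ ^ 2 := by positivity
  have : 0 ≤ τ * ∑ k ∈ Finset.Icc 1 L, w k * b ^ 2 * ‖R k v‖ ^ 2 := by positivity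
  linarith

theorem level_le_energyForm (hε : 0 ≤ ε) (hτ : 0 ≤ τ) (hw : ∀ k ∈ Finset.Icc 1 L, 0 ≤ w k)
    {j : ℕ} (hj : j ∈ Finset.Icc 1 L) (v : V) :
    τ * w j * b ^ 2 * ‖R j v‖ ^ 2 ≤ energyForm ε τ b L w D S R v v := by
  rw [energyForm_self]
  have h1 : w j * b ^ 2 * ‖R j v‖ ^ 2 ≤ ∑ k ∈ Finset.Icc 1 L, w k * b ^ 2 * ‖R k v‖ ^ 2 :=
    Finset.single_le_sum (f := fun k => w k * b ^ 2 * ‖R k v‖ ^ 2)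
      (fun k hk => by have := hw k hk; positivity) hj
  have h2 := mul_le_mul_of_nonneg_left h1 hτ
  have : 0 ≤ ε * ‖D v‖ ^ 2 := by positivity
  have : 0 ≤ ‖S v‖ ^ 2 := by positivity
  linarith

end Energy

theorem exists_ae_norm_le_of_memLp_top {μ : Measure ℝ} {c : ℝ → ℝ} (hc : MemLp c ⊤ μ) :
    ∃ K : ℝ, 0 ≤ K ∧ ∀ᵐ x ∂μ, ‖c x‖ ≤ K := by
  refine ⟨(eLpNorm c ⊤ μ).toReal, ENNReal.toReal_nonneg, ?_⟩
  filter_upwards [ae_le_eLpNormEssSup (f := c) (μ := μ)] with x hx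
  rw [← eLpNorm_exponent_top] at hx
  have := ENNReal.toReal_mono hc.2.ne hx
  simpa using this

theorem memLp_sqrt_top {μ : Measure ℝ} {c : ℝ → ℝ} (hc : MemLp c ⊤ μ) :
    MemLp (fun x => √(c x)) ⊤ μ := by
  obtain ⟨K, -, hK⟩ := exists_ae_norm_le_of_memLp_top hc
  refine memLp_top_of_bound (Real.continuous_sqrt.comp_aestronglyMeasurable hc.1) (√K) ?_
  filter_upwards [hK] with x hx
  rw [Real.norm_of_nonneg (Real.sqrt_nonneg _)]
  exact Real.sqrt_le_sqrt ((le_abs_self _).trans hx)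

theorem mulL_apply {x₀ x₁ : ℝ} {s : ℕ} {w : ℝ → ℝ}
    (hw : MemLp w ⊤ (volume.restrict (Set.Ioo x₀ x₁))) (f : sobolevSpace x₀ x₁ s) :
    mulL s hw f = ((memLp_of_mem_sobolevSpace f).mul (p := ⊤) (r := 2) hw).toLp _ := rfl

theorem norm_mulL_sq {x₀ x₁ : ℝ} {s : ℕ} {w : ℝ → ℝ}
    (hw : MemLp w ⊤ (volume.restrict (Set.Ioo x₀ x₁))) (f : sobolevSpace x₀ x₁ s) :
    ‖mulL s hw f‖ ^ 2 = ∫ x in Set.Ioo x₀ x₁, w x ^ 2 * f.1 x ^ 2 := by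
  rw [mulL_apply, norm_toLp_sq]
  simp [mul_pow]

theorem norm_embL_sq {x₀ x₁ : ℝ} {s : ℕ} (f : sobolevSpace x₀ x₁ s) :
    ‖embL x₀ x₁ s f‖ ^ 2 = ∫ x in Set.Ioo x₀ x₁, f.1 x ^ 2 := by
  rw [embL_apply f (memLp_of_mem_sobolevSpace f), norm_toLp_sq]

theorem norm_mulL_sq_le {x₀ x₁ : ℝ} {s : ℕ} {w : ℝ → ℝ}
    (hw : MemLp w ⊤ (volume.restrict (Set.Ioo x₀ x₁))) {K : ℝ}
    (hK : ∀ᵐ x ∂(volume.restrict (Set.Ioo x₀ x₁)), w x ^ 2 ≤ K) (f : sobolevSpace x₀ x₁ s) :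
    ‖mulL s hw f‖ ^ 2 ≤ K * ‖embL x₀ x₁ s f‖ ^ 2 := by
  rw [norm_mulL_sq, norm_embL_sq, ← integral_const_mul]
  have hf := memLp_of_mem_sobolevSpace f
  refine integral_mono_ae ?_ (hf.integrable_sq.const_mul K) ?_
  · have := (hf.mul (p := ⊤) (r := 2) hw).integrable_sq
    simpa [mul_pow] using this
  · filter_upwards [hK] with x hx
    exact mul_le_mul_of_nonneg_right hx (sq_nonneg _)

theorem le_norm_mulL_sq {x₀ x₁ : ℝ} {s : ℕ} {w : ℝ → ℝ}
    (hw : MemLp w ⊤ (volume.restrict (Set.Ioo x₀ x₁))) {K : ℝ}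
    (hK : ∀ᵐ x ∂(volume.restrict (Set.Ioo x₀ x₁)), K ≤ w x ^ 2) (f : sobolevSpace x₀ x₁ s) :
    K * ‖embL x₀ x₁ s f‖ ^ 2 ≤ ‖mulL s hw f‖ ^ 2 := by
  rw [norm_mulL_sq, norm_embL_sq, ← integral_const_mul]
  have hf := memLp_of_mem_sobolevSpace f
  refine integral_mono_ae (hf.integrable_sq.const_mul K) ?_ ?_
  · have := (hf.mul (p := ⊤) (r := 2) hw).integrable_sq
    simpa [mul_pow] using this
  · filter_upwards [hK] with x hx
    exact mul_le_mul_of_nonneg_right hx (sq_nonneg _)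

theorem inner0_streamDeriv_streamDeriv (x₀ x₁ b : ℝ) (f g : ℝ → ℝ) :
    inner0 x₀ x₁ (streamDeriv x₀ x₁ (fun _ => b) f) (streamDeriv x₀ x₁ (fun _ => b) g) =
      b ^ 2 * inner ℝ ((memLp_weakDeriv x₀ x₁ 1 f).toLp _)
        ((memLp_weakDeriv x₀ x₁ 1 g).toLp _) := by
  rw [inner_toLp_toLp, ← integral_const_mul]
  simp only [inner0, streamDeriv]
  congr 1
  funext x
  ring

theorem norm0_streamDeriv_sq (x₀ x₁ b : ℝ) (f : ℝ → ℝ) :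
    norm0 x₀ x₁ (streamDeriv x₀ x₁ (fun _ => b) f) ^ 2 =
      b ^ 2 * ‖(memLp_weakDeriv x₀ x₁ 1 f).toLp _‖ ^ 2 := by
  have h := inner0_streamDeriv_streamDeriv x₀ x₁ b f f
  rw [real_inner_self_eq_norm_sq] at h
  rw [norm0, Real.sq_sqrt (by rw [h]; positivity), h]

theorem sigma_const (b : ℝ) (c : ℝ → ℝ) : sigma (fun _ => b) c = c := by
  funext x
  simp [sigma]

end

end MQ

open MQ

/-! ### Assembly of the stability theorem. -/

theorem mainTheorem2 (x₀ x₁ : ℝ) (hx : x₀ < x₁) (p L : ℕ) (hp : 2 ≤ p) (hL : 1 ≤ L)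
    (hH1 : MQ.HypothesisH1 x₀ x₁ p L)
    (b : ℝ) (c : ℝ → ℝ) (hc : MemLp c ⊤ (volume.restrict (Set.Ioo x₀ x₁)))
    (σ₀ : ℝ) (hσ₀ : 0 < σ₀)
    (hσ : ∀ᵐ x ∂(volume.restrict (Set.Ioo x₀ x₁)), σ₀ ≤ MQ.sigma (fun _ => b) c x)
    (Cτ : ℝ) (hCτ : 0 < Cτ) (C_Q : ℝ) :
    ∃ β : ℝ, 0 < β ∧
      ∀ (m : ℕ), 1 ≤ m → ∀ (ε : ℝ), 0 < ε →
      ∀ (P : ℕ → (ℝ → ℝ) → (ℝ → ℝ)),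
      (∀ k, 1 ≤ k → k ≤ L → MQ.IsQuasiInterpolant x₀ x₁ p (MQ.numElem L m k) C_Q (P k)) →
      ∀ (τ : ℝ), 0 ≤ τ →
      τ ≤ Cτ * (MQ.levelRatio x₀ x₁ L m L)⁻¹ *
        (MQ.levelSize x₀ x₁ L m 0 ^ 2 / max ε (MQ.levelSize x₀ x₁ L m 0 * |b|)) →
      ∀ u ∈ MQ.fineSpace x₀ x₁ p L m,
        β * MQ.normMQSD x₀ x₁ L m ε τ P (fun _ => b) c u ≤
          sSup {r : ℝ | ∃ v ∈ MQ.fineSpace x₀ x₁ p L m, v ≠ 0 ∧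
            r = MQ.aMQ x₀ x₁ L m ε τ P (fun _ => b) c u v /
              MQ.normMQSD x₀ x₁ L m ε τ P (fun _ => b) c v} := by
  obtain ⟨q, rfl⟩ : ∃ q, p = q + 1 := ⟨p - 1, by omega⟩
  rw [sigma_const] at hσ
  obtain ⟨α, hα, hinfsup⟩ := hH1.exists_test_function
  obtain ⟨Ci, hCi0, hCi⟩ := exists_spline_inverse_inequality (q + 1)
  have hw := memLp_sqrt_top hc
  obtain ⟨Kc, hKc0, hKc⟩ : ∃ K : ℝ, 0 ≤ K ∧ ∀ᵐ x ∂(volume.restrict (Set.Ioo x₀ x₁)),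
      √(c x) ^ 2 ≤ K := by
    obtain ⟨K, hK0, hK⟩ := exists_ae_norm_le_of_memLp_top hc
    refine ⟨K, hK0, ?_⟩
    filter_upwards [hK, hσ] with x hx' hx''
    rw [Real.sq_sqrt (hσ₀.le.trans hx'')]
    exact (le_abs_self _).trans hx'
  -- The four summands bound diffusion, reaction, stabilization and the streamline term. For `b = 0`
  -- the quotient by `|b|` is zero and `K` is still nonnegative; the estimate with `K` is only
  -- needed for `b ≠ 0`.
  set K : ℝ := Cτ * Ci + Cτ * (x₁ - x₀) / |b| * Kc
    + (2 ^ L * L) * C_Q ^ 2 * Cτ ^ 2 * ((x₁ - x₀) ^ 2 + Ci) + Cτ ^ 2 * Ci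
  have hK : 0 ≤ K := by
    have := (sub_pos.2 hx).le
    positivity
  obtain ⟨β, hβ, hmain⟩ := exists_infsup_constant hα hK
  refine ⟨β, hβ, ?_⟩
  intro m hm ε hε P hP τ hτ hτle u hu
  have hN := one_le_numElem hm L 0
  have hle : fineSpace x₀ x₁ (q + 1) L m ≤ sobolevSpace x₀ x₁ 1 := fun f hf =>
    splineSpace_le_sobolevSpace hx hN hf.1
  let ι := Submodule.inclusion hle
  let D := weakDerivL x₀ x₁ (le_refl 1) ∘ₗ ι
  let J := embL x₀ x₁ 1 ∘ₗ ι
  let S := mulL 1 hw ∘ₗ ι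
  have hRex : ∀ k, ∃ R : sobolevSpace x₀ x₁ 1 →ₗ[ℝ] Lp ℝ 2 (volume.restrict (Set.Ioo x₀ x₁)),
      1 ≤ k → k ≤ L → (∀ f : sobolevSpace x₀ x₁ 1,
        R f = (memLp_weakDeriv x₀ x₁ 1 (f.1 - P k f.1)).toLp _) ∧
      (∀ f, ‖R f‖ ^ 2 ≤ C_Q ^ 2 * (‖embL x₀ x₁ 1 f‖ ^ 2 + ‖weakDerivL x₀ x₁ le_rfl f‖ ^ 2)) ∧
      ∀ f, ∃ g, ∃ hg : g ∈ splineSpace x₀ x₁ q (numElem L m k),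
        weakDerivL x₀ x₁ le_rfl f - R f = (memLp_of_mem_splineSpace hg).toLp g := by
    intro k
    by_cases hk : 1 ≤ k ∧ k ≤ L
    · obtain ⟨R, hR⟩ := (hP k hk.1 hk.2).exists_derivative_error hx (one_le_numElem hm L k)
      exact ⟨R, fun _ _ => hR⟩
    · exact ⟨0, fun h h' => absurd ⟨h, h'⟩ hk⟩
  choose R' hR' using hRex
  let R : ℕ → fineSpace x₀ x₁ (q + 1) L m →ₗ[ℝ] Lp ℝ 2 (volume.restrict (Set.Ioo x₀ x₁)) :=
    fun k => R' k ∘ₗ ι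
  have hratio : ∀ k ∈ Finset.Icc 1 L, levelRatio x₀ x₁ L m k = (2 ^ k)⁻¹ := fun k hk =>
    levelRatio_eq hx hm (Finset.mem_Icc.1 hk).2
  have hratio0 : ∀ k ∈ Finset.Icc 1 L, 0 ≤ levelRatio x₀ x₁ L m k := fun k hk => by
    rw [hratio k hk]; positivity
  have hLmem : L ∈ Finset.Icc 1 L := Finset.mem_Icc.2 ⟨hL, le_rfl⟩
  have hγ : levelRatio x₀ x₁ L m L = (2 ^ L)⁻¹ := hratio L hLmem
  set θ := τ * levelRatio x₀ x₁ L m L with hθdef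
  have hθ0 : 0 ≤ θ := mul_nonneg hτ (hratio0 L hLmem)
  let B := energyForm ε τ b L (levelRatio x₀ x₁ L m) D S R
  have hder : ∀ f ∈ fineSpace x₀ x₁ (q + 1) L m, ∃ g ∈ splineSpace x₀ x₁ q (numElem L m 0),
      (∀ x, HasDerivWithinAt f (g x) (Set.Ioi x) x) ∧ IsWeakDeriv x₀ x₁ 1 f g := by
    intro f hf
    obtain ⟨g, hg, hd⟩ := exists_rightDeriv hx hf.1
    exact ⟨g, hg, hd, isWeakDeriv_one_of_mem_splineSpace hx hN hf.1 hg hd⟩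
  have hinv : ∀ z, levelSize x₀ x₁ L m 0 ^ 2 * ‖D z‖ ^ 2 ≤ Ci * ‖J z‖ ^ 2 := by
    intro z
    obtain ⟨g, hg, hd, hwk⟩ := hder z z.2
    have h1 : D z = hwk.2.1.toLp g := weakDerivL_eq le_rfl (ι z) hwk
    rw [h1, norm_toLp_sq, LinearMap.comp_apply, norm_embL_sq]
    exact hCi x₀ x₁ hx _ hN z z.2.1 q g hg hd
  have hcoer := hmain (fineSpace x₀ x₁ (q + 1) L m) (Lp ℝ 2 (volume.restrict (Set.Ioo x₀ x₁)))
    B D J b θ σ₀ (fun v => D v - R L v)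
    (energyForm_nonneg hε.le hτ hratio0) isSymm_energyForm hθ0 hσ₀
    (fun v => (le_norm_mulL_sq hw (by
      filter_upwards [hσ] with x hx'
      rwa [Real.sq_sqrt (hσ₀.le.trans hx')]) (ι v)).trans
        (norm_sq_le_energyForm (D := D) (S := S) (R := R) hε.le hτ hratio0 v))
    (fun v => by
      obtain ⟨g, hg, hd, hwk⟩ := hder v v.2
      have h1 : D v = hwk.2.1.toLp g := weakDerivL_eq le_rfl (ι v) hwk
      have h2 : J v = hwk.1.toLp v.1 := embL_apply (ι v) hwk.1
      rw [h1, h2, inner_toLp_toLp]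
      exact integral_rightDeriv_mul_self hx hN v.2 hg hd)
    (fun v => by
      rw [sub_sub_cancel]
      exact level_le_energyForm hε.le hτ hratio0 hLmem v)
    (fun hb z => by
      have hτθ : τ = θ * 2 ^ L := by
        rw [hθdef, hγ]; field_simp
      -- Each of the `L` levels has `c_k ≤ 1`, and rewriting `τ = θ / c_L` costs the factor `2 ^ L`.
      have hs : τ * ∑ k ∈ Finset.Icc 1 L, levelRatio x₀ x₁ L m k * b ^ 2 * ‖R k z‖ ^ 2
          ≤ θ * (2 ^ L * L) * (b ^ 2 * (C_Q ^ 2 * (‖J z‖ ^ 2 + ‖D z‖ ^ 2))) := by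
        have h1 : ∑ k ∈ Finset.Icc 1 L, levelRatio x₀ x₁ L m k * b ^ 2 * ‖R k z‖ ^ 2 ≤
            ∑ k ∈ Finset.Icc 1 L, b ^ 2 * (C_Q ^ 2 * (‖J z‖ ^ 2 + ‖D z‖ ^ 2)) := by
          refine Finset.sum_le_sum fun k hk => ?_
          have h2 : levelRatio x₀ x₁ L m k ≤ 1 := by
            rw [hratio k hk]
            exact inv_le_one_of_one_le₀ (one_le_pow₀ one_le_two)
          have h3 : ‖R k z‖ ^ 2 ≤ C_Q ^ 2 * (‖J z‖ ^ 2 + ‖D z‖ ^ 2) :=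
            (hR' k (Finset.mem_Icc.1 hk).1 (Finset.mem_Icc.1 hk).2).2.1 (ι z)
          rw [mul_assoc]
          exact (mul_le_of_le_one_left (by positivity) h2).trans
            (mul_le_mul_of_nonneg_left h3 (sq_nonneg b))
        rw [Finset.sum_const, Nat.card_Icc, Nat.add_sub_cancel, nsmul_eq_mul] at h1
        calc _ ≤ τ * (L * (b ^ 2 * (C_Q ^ 2 * (‖J z‖ ^ 2 + ‖D z‖ ^ 2)))) :=
              mul_le_mul_of_nonneg_left h1 hτ
          _ = _ := by rw [hτθ]; ring
      have hθle : θ ≤ Cτ * (levelSize x₀ x₁ L m 0 ^ 2 /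
          max ε (levelSize x₀ x₁ L m 0 * |b|)) := by
        have := mul_le_mul_of_nonneg_right hτle (hratio0 L hLmem)
        refine this.trans (le_of_eq ?_)
        rw [hγ]
        field_simp
      simp only [B]
      rw [energyForm_self]
      exact stabilization_energy_le hb hCτ hKc0 (meshSize_pos hx hN) (levelSize_zero_le hx hm) hθ0
        hε (by positivity) hθle (sq_nonneg _) (sq_nonneg _) (hinv z)
        (norm_mulL_sq_le hw hKc (ι z)) le_rfl hs)
    -- H1 enters here: `D v - R L v` is the derivative of `Π_L v`, a spline of degree `q` on the
    -- coarsest mesh.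
    (fun v hv => by
      obtain ⟨g, hg, hgv⟩ := (hR' L hL le_rfl).2.2 (ι v)
      change D v - R L v = _ at hgv
      have hg2 := memLp_of_mem_splineSpace hg
      simp only [hgv] at hv ⊢
      obtain ⟨z, hz, hz0, hzg⟩ := hinfsup m hm g hg (by
        rw [norm0_eq_norm hg2]
        exact norm_ne_zero_iff.2 hv)
      have hz2 : MemLp z 2 (volume.restrict (Set.Ioo x₀ x₁)) := memLp_of_mem_splineSpace hz.1
      have hJz : J ⟨z, hz⟩ = hz2.toLp z := embL_apply (ι ⟨z, hz⟩) hz2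
      rw [norm0_eq_norm hz2] at hz0
      rw [norm0_eq_norm hz2, norm0_eq_norm hg2, inner0_eq_inner hz2 hg2, real_inner_comm] at hzg
      refine ⟨⟨z, hz⟩, ?_, ?_⟩
      · rw [hJz]
        exact norm_ne_zero_iff.1 hz0
      · rw [hJz]
        exact hzg)
  have hsMQ : ∀ v w : fineSpace x₀ x₁ (q + 1) L m,
      sMQ x₀ x₁ L m τ P (fun _ => b) v.1 w.1 =
        τ * ∑ k ∈ Finset.Icc 1 L, levelRatio x₀ x₁ L m k * b ^ 2 * inner ℝ (R k v) (R k w) := by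
    intro v w
    rw [sMQ]
    congr 1
    refine Finset.sum_congr rfl fun k hk => ?_
    have h := (hR' k (Finset.mem_Icc.1 hk).1 (Finset.mem_Icc.1 hk).2).1
    rw [inner0_streamDeriv_streamDeriv, mul_assoc]
    have hv : R k v = _ := h (ι v)
    have hw : R k w = _ := h (ι w)
    rw [hv, hw]
    rfl
  have hnorm : ∀ v : fineSpace x₀ x₁ (q + 1) L m,
      normMQSD x₀ x₁ L m ε τ P (fun _ => b) c v.1 = √(B v v + θ * b ^ 2 * ‖D v‖ ^ 2) := by
    intro v
    have hDv : D v = (memLp_weakDeriv x₀ x₁ 1 v.1).toLp _ := rfl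
    have hSv : norm0 x₀ x₁ (fun x => √(c x) * v.1 x) = ‖S v‖ :=
      norm0_eq_norm ((memLp_of_mem_sobolevSpace (ι v)).mul (p := ⊤) (r := 2) hw)
    rw [normMQSD, normG, sigma_const, Real.sq_sqrt (by positivity), hsMQ, norm0_streamDeriv_sq,
      hSv, norm0_eq_norm (memLp_weakDeriv x₀ x₁ 1 v.1), ← hDv]
    simp only [B, energyForm_self, real_inner_self_eq_norm_sq]
    rw [← hθdef, ← mul_assoc]
  have haform : ∀ v w : fineSpace x₀ x₁ (q + 1) L m,
      aMQ x₀ x₁ L m ε τ P (fun _ => b) c v.1 w.1 = B v w + b * inner ℝ (D v) (J w) := by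
    intro v w
    have hw2 : MemLp w.1 2 (volume.restrict (Set.Ioo x₀ x₁)) := memLp_of_mem_splineSpace w.2.1
    have h1 : inner0 x₀ x₁ (weakDeriv x₀ x₁ 1 v.1) (weakDeriv x₀ x₁ 1 w.1)
        = inner ℝ (D v) (D w) :=
      inner0_eq_inner (memLp_weakDeriv x₀ x₁ 1 v.1) (memLp_weakDeriv x₀ x₁ 1 w.1)
    have h2 : inner0 x₀ x₁ (streamDeriv x₀ x₁ (fun _ => b) v.1) w.1
        = b * inner ℝ (D v) (J w) := by
      have hJw : J w = hw2.toLp w.1 := embL_apply (ι w) hw2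
      have hDv : D v = (memLp_weakDeriv x₀ x₁ 1 v.1).toLp _ := rfl
      rw [hJw, hDv, inner_toLp_toLp, ← integral_const_mul]
      simp only [inner0, streamDeriv, mul_assoc]
    have h3 : inner0 x₀ x₁ (fun x => c x * v.1 x) w.1 = inner ℝ (S v) (S w) := by
      have hS : inner ℝ (S v) (S w)
          = ∫ x in Set.Ioo x₀ x₁, (√(c x) * v.1 x) * (√(c x) * w.1 x) :=
        inner_toLp_toLp ((memLp_of_mem_sobolevSpace (ι v)).mul (p := ⊤) (r := 2) hw)
          ((memLp_of_mem_sobolevSpace (ι w)).mul (p := ⊤) (r := 2) hw)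
      rw [hS]
      -- The factorization `c = √c · √c` holds only almost everywhere, where `c ≥ σ₀ > 0`.
      refine integral_congr_ae ?_
      filter_upwards [hσ] with x hx'
      have := Real.mul_self_sqrt (hσ₀.le.trans hx')
      linear_combination (-(v.1 x * w.1 x)) * this
    rw [aMQ, aForm, h1, h2, h3, hsMQ]
    simp only [B, energyForm_apply]
    ring
  have hset : {r : ℝ | ∃ v ∈ fineSpace x₀ x₁ (q + 1) L m, v ≠ 0 ∧
      r = aMQ x₀ x₁ L m ε τ P (fun _ => b) c u v / normMQSD x₀ x₁ L m ε τ P (fun _ => b) c v} =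
      {r : ℝ | ∃ v : fineSpace x₀ x₁ (q + 1) L m, v ≠ 0 ∧
        r = (B ⟨u, hu⟩ v + b * inner ℝ (D ⟨u, hu⟩) (J v)) /
          √(B v v + θ * b ^ 2 * ‖D v‖ ^ 2)} := by
    ext r
    constructor
    · rintro ⟨v, hv, hv0, rfl⟩
      refine ⟨⟨v, hv⟩, fun h => hv0 (congrArg Subtype.val h), ?_⟩
      rw [← haform ⟨u, hu⟩ ⟨v, hv⟩, ← hnorm ⟨v, hv⟩]
    · rintro ⟨v, hv0, rfl⟩
      refine ⟨v.1, v.2, fun h => hv0 (Subtype.ext h), ?_⟩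
      rw [← haform ⟨u, hu⟩ v, ← hnorm v]
  rw [hset, hnorm ⟨u, hu⟩]
  exact hcoer ⟨u, hu⟩
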